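/- \textbf{Theorem.} Every $2$-fixed instance of \textsc{Simultaneous PQ-Ordering} is $1$-critical. \emph{Instances.} An (unrooted) PQ-tree with finite leaf set $L$ is either the null tree, representing no order, or a tree with leaves $L$ whose inner nodes have degree at least $3$ and are P-nodes (the incident edges may be ordered arbitrarily) or Q-nodes (the circular order of the incident edges is fixed up to reversal); it represents the set of circular orders of $L$ arising from such choices. An instance is a finite directed acyclic multigraph $D$ whose nodes are PQ-trees $T_i$ with leaf sets $L_i$, representing sets of orders $\mathcal L_i$. Every arc $(T_i,T_j;\varphi)$ carries an injective map $\varphi\colon L_j\to L_i$. The instance is normalized: for every arc, every order in $\mathcal L_j$ extends along $\varphi$ to an order in $\mathcal L_i$. Children of a tree are counted by outgoing arcs, and parents by incoming arcs. \emph{Fixedness.} Let $\mu$ be a P-node of $T$ and let $(T,T';\varphi)$ be an arc. If the images under $\varphi$ of the leaves of $T'$ belong to at least three different edges incident to $\mu$, then $\mu$ is \emph{fixed} with respect to this child, and these edges are the fixed edges; here a leaf belongs to the incident edge through which it is reached from $\mu$. A P-node $\mu'$ of $T'$ \emph{stems from} $\mu$ if leaves belonging to three different edges at $\mu'$ are mapped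 by $\varphi$ to leaves belonging to three different edges at $\mu$. The fixedness is defined recursively along the directed acyclic graph by $$\mathrm{fixed}(\mu)=k'+\sum_i(\mathrm{fixed}(\mu_i)-1),$$ where $k'$ is the number of children fixing $\mu$ and $\mu_i$ runs over the P-nodes in the parents from which $\mu$ stems (one for each incoming arc; a parent in which $\mu$ stems from no P-node, which is possible only if $\mu$ has degree $3$, contributes nothing). The instance is \emph{$2$-fixed} if $\mathrm{fixed}(\mu)\le 2$ for all P-nodes $\mu$. \emph{Expansion.} A \emph{critical triple} $(\mu,T_1,T_2)$ consists of a P-node $\mu$ in a tree $T$ and an unordered pair of different arcs from $T$, to $T_1$ and to $T_2$ (possibly $T_1=T_2$), such that $\mu$ is fixed with respect to both. Starting from $D$, unprocessed critical triples are processed one after the other as follows. \begin{itemize} \item \emph{Expansion step}: add an expansion tree $T(\mu,T_1,T_2)$ whose leaves are the edges incident to $\mu$ that are fixed with respect to both children. It represents the intersection of the projections of $T_1$ and $T_2$ to representatives of these edges. Also add the arcs to it from $T_1$ and from $T_2$ given by the representatives. \item \emph{Finalizing step}, applied instead if $T_1$ and $T_2$ both consist of a single P-node, fix the same edges at $\mu$,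 and $T_1\neq T_2$: add an arc from one of $T_1,T_2$ to the other, whose map identifies the leaves belonging to the same edge at $\mu$, directed so that no directed cycle arises. \item If the condition of a finalizing step holds but $T_1=T_2$, then only mark the triple as processed if $T_1$ is an expansion tree, and otherwise apply an expansion step. \end{itemize} The graph in which no unprocessed critical triples are left is the expansion graph. The instance $D$ is \emph{$1$-critical} if every P-node of every tree in the expansion graph is contained in at most one critical triple. Since steps only add trees and arcs, this is the same as requiring it at every stage of the expansion, and it is asserted here for every stage, whatever the order of the steps and the choices made in them. -/

import Mathlib

namespace SimPQ

open Sum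

/-! ### Circular orders

A circular order of a finite set is a term of Mathlib's `CircularOrder`; `O.sbtw a b c` says that
the pairwise distinct elements `a`, `b`, `c` occur in this cyclic sequence. -/

/-- `O'` is the suborder of `O` along the map `f`, that is, `O` is an extension of `f(O')`. -/
def IsSuborder {S L : Type} (f : S → L) (O' : CircularOrder S) (O : CircularOrder L) : Prop :=
  ∀ x y z : S, O'.sbtw x y z ↔ O.sbtw (f x) (f y) (f z)

/-! ### PQ-trees -/

/-- An (unrooted, non-null) PQ-tree with leaf set `L`: a finite tree on the leaves `L` and the
inner nodes `Inner`; leaves have degree at most one (degree `0` only if the tree is a single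
vertex) and inner nodes have degree at least three. Every inner node `μ` is a P-node
(`kind μ = none`), or a Q-node (`kind μ = some c`), whose incident edges have the
circular order `c`, fixed up to reversal. The edges incident to `μ` are
identified with the neighbours of `μ`. -/
structure PQTree (L : Type) where
  Inner : Type
  finite_inner : Finite Inner
  G : SimpleGraph (L ⊕ Inner)
  preconnected : G.Preconnected
  acyclic : G.IsAcyclic
  leaf_deg : ∀ l : L, (G.neighborSet (inl l)).Subsingleton
  inner_deg : ∀ μ : Inner, 3 ≤ (G.neighborSet (inr μ)).encard
  kind : ∀ μ : Inner, Option (CircularOrder (G.neighborSet (inr μ)))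

namespace PQTree

variable {L : Type}

/-- The edges incident to the inner node `μ`. -/
abbrev Edge (T : PQTree L) (μ : T.Inner) : Type := T.G.neighborSet (inr μ)

/-- `μ` is a P-node. -/
def IsP (T : PQTree L) (μ : T.Inner) : Prop := T.kind μ = none

/-- The leaf `l` belongs to the edge `e` with respect to `μ`: after removing `e` from the tree,
`l` lies in the component that contains the endpoint of `e` other than `μ`. -/
def Belongs (T : PQTree L) (μ : T.Inner) (e : T.Edge μ) (l : L) : Prop :=
  (T.G.deleteEdges {s(inr μ, e.1)}).Reachable e.1 (inl l)

/-- The leaves `a`, `b`, `c` belong to three different edges incident to `μ`. -/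
def Separates (T : PQTree L) (μ : T.Inner) (a b c : L) : Prop :=
  ∃ x y z : T.Edge μ, x ≠ y ∧ y ≠ z ∧ x ≠ z ∧
    T.Belongs μ x a ∧ T.Belongs μ y b ∧ T.Belongs μ z c

/-- The circular order `O` of the leaves is represented by `T`: there is a choice `σ` of circular
orders of the edges around all inner nodes, arbitrary around P-nodes and the given one or
its reversal around Q-nodes, such that `O` is the order of the leaves in the resulting embedding.
Three leaves that belong to three different edges at `μ` (every three distinct leaves do so
for exactly one `μ`) are ordered as these edges are around `μ`. -/
def Represents (T : PQTree L) (O : CircularOrder L) : Prop :=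
  ∃ σ : ∀ μ : T.Inner, CircularOrder (T.Edge μ),
    (∀ (μ : T.Inner) (c : CircularOrder (T.Edge μ)), T.kind μ = some c →
      (∀ x y z, (σ μ).sbtw x y z ↔ c.sbtw x y z) ∨
      (∀ x y z, (σ μ).sbtw x y z ↔ c.sbtw z y x)) ∧
    ∀ (μ : T.Inner) (x y z : T.Edge μ) (a b c : L), x ≠ y → y ≠ z → x ≠ z →
      T.Belongs μ x a → T.Belongs μ y b → T.Belongs μ z c →
      (O.sbtw a b c ↔ (σ μ).sbtw x y z)

end PQTree

/-- The set of orders represented by a PQ-tree that may be the null tree `none`. -/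
def orders {L : Type} : Option (PQTree L) → Set (CircularOrder L)
  | none => ∅
  | some T => {O | T.Represents O}

/-! ### Directed multigraphs of PQ-trees -/

/-- A directed multigraph whose nodes carry PQ-trees. The leaf set of the tree at node `i` is
`Leaf i`, and an arc `a` carries a map from the leaves of its target to those of its source. -/
structure PQGraph where
  Node : Type
  Arc : Type
  Leaf : Node → Type
  tree : ∀ i, Option (PQTree (Leaf i))
  src : Arc → Node
  tgt : Arc → Node
  map : ∀ a, Leaf (tgt a) → Leaf (src a)

namespace PQGraph

variable (D : PQGraph)

/-- There is an arc from `i` to `j`. -/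
def Adj (i j : D.Node) : Prop := ∃ a, D.src a = i ∧ D.tgt a = j

/-- A P-node of one of the trees of `D`. -/
structure PNode where
  node : D.Node
  T : PQTree (D.Leaf node)
  tree_eq : D.tree node = some T
  μ : T.Inner
  isP : T.IsP μ

/-- The arc `a` starts at the tree containing `p`, and the leaf `l` of its target, seen as a leaf
of its source, belongs to the edge `e` incident to `p`. -/
def Hits (p : D.PNode) (a : D.Arc) (l : D.Leaf (D.tgt a)) (e : p.T.Edge p.μ) : Prop :=
  ∃ h : D.src a = p.node, p.T.Belongs p.μ e (h ▸ D.map a l)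

/-- The edges incident to `p` to which some leaf of the target of `a` belongs. If there are at least
three of them, they are the edges incident to `p` that are fixed with respect to `a`;
otherwise `p` disappears in the projection. -/
def hitEdges (p : D.PNode) (a : D.Arc) : Set (p.T.Edge p.μ) := {e | ∃ l, D.Hits p a l e}

/-- The P-node `p` is fixed with respect to the child given by the arc `a`: it is still an inner
node (of degree at least three) of the projection to the leaves of the child. -/
def Fixes (a : D.Arc) (p : D.PNode) : Prop := 3 ≤ (D.hitEdges p a).encard

/-- `(p, a, b)` is a critical triple: `a` and `b` are different arcs, that is, two children, with
possibly the same target, and `p` is fixed with respect to both. -/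
def IsCritical (p : D.PNode) (a b : D.Arc) : Prop := a ≠ b ∧ D.Fixes a p ∧ D.Fixes b p

/-- Every P-node is contained in at most one critical triple (triples are unordered in the
two children). -/
def AtMostOneCritical : Prop :=
  ∀ (p : D.PNode) (a b a' b' : D.Arc),
    D.IsCritical p a b → D.IsCritical p a' b' → s(a, b) = s(a', b')

/-- The P-node `p` of the target of `a` stems from the P-node `q` of the source of `a`: leaves that
belong to three different edges at `p` belong to three different edges at `q`. -/
def Stems (p : D.PNode) (a : D.Arc) (q : D.PNode) : Prop :=
  ∃ (h : D.tgt a = p.node) (h' : D.src a = q.node), ∀ l₁ l₂ l₃ : D.Leaf (D.tgt a),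
    p.T.Separates p.μ (h ▸ l₁) (h ▸ l₂) (h ▸ l₃) →
    q.T.Separates q.μ (h' ▸ D.map a l₁) (h' ▸ D.map a l₂) (h' ▸ D.map a l₃)

end PQGraph

/-- A (normalized) instance of Simultaneous PQ-Ordering: a finite directed acyclic multigraph of
PQ-trees with finite leaf sets and injective maps at the arcs, such that every order represented
by the target of an arc extends to an order represented by its source. -/
structure Instance extends PQGraph where
  finite_node : Finite Node
  finite_arc : Finite Arc
  finite_leaf : ∀ i, Finite (Leaf i)
  injective_map : ∀ a, Function.Injective (map a)
  acyclic : ∀ i, ¬ Relation.TransGen toPQGraph.Adj i i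
  normalized : ∀ a, ∀ O' ∈ orders (tree (tgt a)), ∃ O ∈ orders (tree (src a)),
    IsSuborder (map a) O' O

/-! ### Fixedness -/

namespace Instance

variable (D : Instance)

/-- The relation "`q` lies in a parent of the tree of `p`, and `p` stems from `q`". -/
def StemRel (q p : D.PNode) : Prop := ∃ a, D.Stems p a q

theorem stemRel_wf : WellFounded D.StemRel := by
  have := D.finite_node
  have hw : WellFounded (Relation.TransGen D.toPQGraph.Adj) := by
    have : Std.Irrefl (Relation.TransGen D.toPQGraph.Adj) := ⟨D.acyclic⟩
    exact Finite.wellFounded_of_trans_of_irrefl _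
  refine Subrelation.wf ?_ (InvImage.wf (fun p : D.PNode => p.node) hw)
  rintro q p ⟨a, h, h', -⟩
  exact Relation.TransGen.single ⟨a, h', h⟩

/-- The fixedness of a P-node `p`: the number of children fixing it, plus the sum of
`fixedness q - 1` over all incoming arcs and P-nodes `q` of the corresponding
parent from which `p` stems (for each incoming arc there is at most one such `q`). -/
noncomputable def fixedness : D.PNode → ℤ :=
  D.stemRel_wf.fix fun p rec =>
    ({a | D.Fixes a p}.ncard : ℤ) +
      ∑ᶠ s : {s : D.Arc × D.PNode // D.Stems p s.1 s.2}, (rec s.1.2 ⟨s.1.1, s.2⟩ - 1)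

theorem fixedness_eq (p : D.PNode) : D.fixedness p =
    ({a | D.Fixes a p}.ncard : ℤ) +
      ∑ᶠ s : {s : D.Arc × D.PNode // D.Stems p s.1 s.2}, (D.fixedness s.1.2 - 1) :=
  D.stemRel_wf.fix_eq _ p

/-- `D` is `k`-fixed if all its P-nodes have fixedness at most `k`. -/
def IsFixed (k : ℤ) : Prop := ∀ p : D.PNode, D.fixedness p ≤ k

end Instance

/-! ### Expansion -/

namespace PQGraph

variable (D : PQGraph)

/-- Add a new node with tree `t` and two arcs to it, from the targets of `a` and `b`. -/
def addNode {L : Type} (t : Option (PQTree L)) (a b : D.Arc)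
    (f : L → D.Leaf (D.tgt a)) (g : L → D.Leaf (D.tgt b)) : PQGraph where
  Node := Option D.Node
  Arc := D.Arc ⊕ Bool
  Leaf
    | some i => D.Leaf i
    | none => L
  tree
    | some i => D.tree i
    | none => t
  src
    | inl c => some (D.src c)
    | inr false => some (D.tgt a)
    | inr true => some (D.tgt b)
  tgt
    | inl c => some (D.tgt c)
    | inr _ => none
  map
    | inl c => D.map c
    | inr false => f
    | inr true => g

/-- Add a new arc from `i` to `j`. -/
def addArc (i j : D.Node) (f : D.Leaf j → D.Leaf i) : PQGraph where
  Node := D.Node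
  Arc := Option D.Arc
  Leaf := D.Leaf
  tree := D.tree
  src
    | some c => D.src c
    | none => i
  tgt
    | some c => D.tgt c
    | none => j
  map
    | some c => D.map c
    | none => f

variable {D}

/-- A P-node of `D` as a P-node of the graph with an additional node. -/
def PNode.addNode (p : D.PNode) {L : Type} (t : Option (PQTree L)) (a b : D.Arc)
    (f : L → D.Leaf (D.tgt a)) (g : L → D.Leaf (D.tgt b)) : (D.addNode t a b f g).PNode :=
  ⟨some p.node, p.T, p.tree_eq, p.μ, p.isP⟩

/-- A P-node of `D` as a P-node of the graph with an additional arc. -/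
def PNode.addArc (p : D.PNode) (i j : D.Node) (f : D.Leaf j → D.Leaf i) :
    (D.addArc i j f).PNode :=
  ⟨p.node, p.T, p.tree_eq, p.μ, p.isP⟩

variable (D)

/-- The tree at node `i` consists of a single P-node (and its leaves). -/
def IsSinglePNode (i : D.Node) : Prop :=
  ∃ (T : PQTree (D.Leaf i)) (μ : T.Inner), D.tree i = some T ∧ T.IsP μ ∧ ∀ ν, ν = μ

/-- The condition on a critical triple for a finalizing step: both children consist of a
single P-node and fix the same edges incident to `p`. -/
def IsFinalizable (p : D.PNode) (a b : D.Arc) : Prop :=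
  D.IsSinglePNode (D.tgt a) ∧ D.IsSinglePNode (D.tgt b) ∧ D.hitEdges p a = D.hitEdges p b

/-- The edges incident to `p` that are fixed with respect to both children of a critical triple. -/
abbrev CommonEdge (p : D.PNode) (a b : D.Arc) : Type :=
  ↥(D.hitEdges p a ∩ D.hitEdges p b)

/-- `t` is an expansion tree for the critical triple `(p, a, b)`. Its leaves are the common fixed
edges; `f` and `g` choose for every common fixed edge a representative among the leaves of the
two children; and `t` represents the intersection of the projections of the children
to these representatives. -/
def IsExpansionTree (p : D.PNode) (a b : D.Arc) (t : Option (PQTree (D.CommonEdge p a b)))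
    (f : D.CommonEdge p a b → D.Leaf (D.tgt a)) (g : D.CommonEdge p a b → D.Leaf (D.tgt b)) :
    Prop :=
  (∀ e, D.Hits p a (f e) e.1) ∧ (∀ e, D.Hits p b (g e) e.1) ∧
  orders t = {O | (∃ O₁ ∈ orders (D.tree (D.tgt a)), IsSuborder f O O₁) ∧
                  (∃ O₂ ∈ orders (D.tree (D.tgt b)), IsSuborder g O O₂)}

end PQGraph

/-- A stage of the expansion: the current graph, the set of its expansion trees, and the
set of critical triples that are already processed. -/
structure Stage extends PQGraph where
  expTree : Set Node
  processed : Set (toPQGraph.PNode × Sym2 Arc)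

/-- One step of the expansion, which processes one unprocessed critical triple. -/
inductive Step : Stage → Stage → Prop
  /-- Expansion step: add an expansion tree and the arcs to it from the two children. It is applied
  if no finalizing step is possible, and also to parallel arcs that satisfy the condition of a
  finalizing step if their common target is not itself an expansion tree. -/
  | expand (E : Stage) (p : E.PNode) (a b : E.Arc)
      (t : Option (PQTree (E.CommonEdge p a b)))
      (f : E.CommonEdge p a b → E.Leaf (E.tgt a)) (g : E.CommonEdge p a b → E.Leaf (E.tgt b))
      (crit : E.IsCritical p a b) (unproc : (p, s(a, b)) ∉ E.processed)
      (cond : ¬ E.IsFinalizable p a b ∨ (E.tgt a = E.tgt b ∧ E.tgt a ∉ E.expTree))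
      (exp : E.IsExpansionTree p a b t f g) :
      Step E
        { toPQGraph := E.toPQGraph.addNode t a b f g
          expTree := insert none (some '' E.expTree)
          processed := (fun s => (s.1.addNode t a b f g, s.2.map inl)) ''
            insert (p, s(a, b)) E.processed }
  /-- Finalizing step: add an arc from the first child to the second one, where the second does not
  reach the first; its map identifies the leaves that belong to the same edge at `p`. -/
  | finalize (E : Stage) (p : E.PNode) (a b : E.Arc) (f : E.Leaf (E.tgt b) → E.Leaf (E.tgt a))
      (crit : E.IsCritical p a b) (unproc : (p, s(a, b)) ∉ E.processed)
      (cond : E.IsFinalizable p a b)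
      (path : ¬ Relation.ReflTransGen E.toPQGraph.Adj (E.tgt b) (E.tgt a))
      (hf : ∀ l, ∃ e, E.Hits p b l e ∧ E.Hits p a (f l) e) :
      Step E
        { toPQGraph := E.toPQGraph.addArc (E.tgt a) (E.tgt b) f
          expTree := E.expTree
          processed := (fun s => (s.1.addArc (E.tgt a) (E.tgt b) f, s.2.map some)) ''
            insert (p, s(a, b)) E.processed }
  /-- Critical double arc into an expansion tree: only mark the triple as processed. -/
  | doubleArc (E : Stage) (p : E.PNode) (a b : E.Arc)
      (crit : E.IsCritical p a b) (unproc : (p, s(a, b)) ∉ E.processed)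
      (cond : E.IsFinalizable p a b) (tgt_eq : E.tgt a = E.tgt b) (mem : E.tgt a ∈ E.expTree) :
      Step E
        { toPQGraph := E.toPQGraph
          expTree := E.expTree
          processed := insert (p, s(a, b)) E.processed }

namespace Instance

variable (D : Instance)

/-- The initial stage: no expansion trees, and no processed critical triples. -/
def initialStage : Stage where
  toPQGraph := D.toPQGraph
  expTree := ∅
  processed := ∅

/-- `E` is obtained from `D` by finitely many steps of the expansion, in any order and with any
choice of representatives and of the direction of the finalizing arcs. -/
def ExpandsTo (E : Stage) : Prop := Relation.ReflTransGen Step D.initialStage E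

/-- `E` is an expansion graph of `D`: no unprocessed critical triples are left. -/
def IsExpansionGraph (E : Stage) : Prop :=
  D.ExpandsTo E ∧ ∀ (p : E.PNode) (a b : E.Arc), E.IsCritical p a b → (p, s(a, b)) ∈ E.processed

/-- `D` is 1-critical. The condition is imposed on every stage of the expansion, and so
in particular on the expansion graph `D.IsExpansionGraph E`. Since steps only
add trees and arcs, the expansion graph satisfies it exactly if all stages before it do. -/
def IsOneCritical : Prop := ∀ E : Stage, D.ExpandsTo E → E.AtMostOneCritical

variable {D} in
theorem IsOneCritical.expansionGraph (h : D.IsOneCritical) {E : Stage}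
    (hE : D.IsExpansionGraph E) : E.AtMostOneCritical := h E hE.1

end Instance

end SimPQ

/-! The proof bounds, at every stage of the expansion, the arcs that fix a P-node `p` together with
those that may still be created. A step on a triple `(μ, a, b)` can create an arc fixing an old
P-node `p` only if `p` stems from `μ` through `a` or `b`, and afterwards the triple is processed. So
each incoming arc through which `p` stems from a P-node of a critical triple is a credit, redeemable
once for a fixing arc. `Stage.load` counts the fixing arcs of `p` plus the unredeemed credits.

The invariant is that loads are at most 2, and at most 1 outside a set `H` that contains the P-nodes
of all critical triples. With at most two fixing arcs there is at most one critical triple at each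
P-node.

Initially `H` consists of the P-nodes of fixedness 2. A P-node from which another one stems is fixed
by some child, so its fixedness is 1 or 2 and it contributes 0 or 1 to the recursion. Hence the load
is at most the fixedness (`Instance.encard_load_le`). P-nodes of a new expansion tree have no
outgoing arcs and two incoming ones, so they may join `H`. For old P-nodes each step maps part of
the old load onto the new load (`Stage.Invariant.expand`, `Stage.Invariant.finalize`).

Redeeming a credit requires that `p` really stems from `μ` once a single triple of leaves is
separated at both. This uniformity follows from normalization. At a P-node of the child, two leaves
on different edges can be positioned independently with respect to two other leaves
(`PQTree.exists_represents_sbtw`). In the parent they could not if they shared an edge at `μ`.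
Exchanging leaves one at a time gives `PQTree.Separates.of_separates`. Finalizing arcs are uniform
because both trees are single P-nodes. -/

namespace SimPQ

open Sum

/-! ### Trees -/

section Tree

variable {V : Type} {G : SimpleGraph V}

/-- After removing the edge between `m` and `x`, the vertex `v` lies in the component of `x`. -/
def Beyond (G : SimpleGraph V) (m x v : V) : Prop := (G.deleteEdges {s(m, x)}).Reachable x v

/-- A walk in a component that avoids `m` uses no edge at `m`, so any such edge may be deleted
instead. -/
theorem reachable_deleteEdges_of_not_reachable {G' : SimpleGraph V} (hle : G' ≤ G) {u v m : V}
    (y : V) (h : G'.Reachable u v) (hm : ¬ G'.Reachable u m) :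
    (G.deleteEdges {s(m, y)}).Reachable u v := by
  obtain ⟨w⟩ := h
  induction w with
  | nil => exact .rfl
  | @cons u w v huw p ih =>
    have hw : ¬ G'.Reachable w m := fun hw => hm (huw.reachable.trans hw)
    refine SimpleGraph.Reachable.trans (SimpleGraph.Adj.reachable ?_) (ih hw)
    rw [SimpleGraph.deleteEdges_adj]
    refine ⟨hle huw, ?_⟩
    rintro h
    have hmem : m ∈ s(u, w) := by rw [Set.mem_singleton_iff.1 h]; simp
    rcases Sym2.mem_iff.1 hmem with rfl | rfl
    · exact hm .rfl
    · exact hw .rfl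

theorem not_reachable_deleteEdges (ha : G.IsAcyclic) {m x : V} (h : G.Adj m x) :
    ¬ (G.deleteEdges {s(m, x)}).Reachable m x := by
  have := SimpleGraph.isAcyclic_iff_forall_adj_isBridge.1 ha h
  rw [SimpleGraph.isBridge_iff] at this
  exact this

/-- On a walk from `v` to `m`, the end at which the edge is first met decides the side; a walk that
never uses it ends at `m`. -/
theorem beyond_or_beyond (hc : G.Preconnected) (m x v : V) : Beyond G m x v ∨ Beyond G x m v := by
  unfold Beyond
  rw [Sym2.eq_swap (a := x)]
  obtain ⟨w⟩ := hc v m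
  induction w with
  | nil => exact .inr .rfl
  | @cons u w v huw p ih =>
    by_cases he : s(w, u) = s(v, x)
    · have hmem : u ∈ s(v, x) := by rw [← he]; simp
      rcases Sym2.mem_iff.1 hmem with rfl | rfl
      · exact .inr .rfl
      · exact .inl .rfl
    · have hwu : (G.deleteEdges {s(v, x)}).Reachable w u :=
        SimpleGraph.Adj.reachable (by rw [SimpleGraph.deleteEdges_adj]; exact ⟨huw.symm, he⟩)
      exact ih.imp (·.trans hwu) (·.trans hwu)

theorem Beyond.not_swap (ha : G.IsAcyclic) {m x v : V} (h : G.Adj m x) (hv : Beyond G m x v) :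
    ¬ Beyond G x m v := by
  intro hv'
  unfold Beyond at hv hv'
  rw [Sym2.eq_swap] at hv'
  exact not_reachable_deleteEdges ha h (hv'.trans hv.symm)

theorem not_beyond_self (ha : G.IsAcyclic) {m x : V} (h : G.Adj m x) : ¬ Beyond G m x m :=
  fun hv => not_reachable_deleteEdges ha h (SimpleGraph.Reachable.symm hv)

/-- Otherwise the route from `m` over `x` and `v` to `y` would bypass the bridge between `m` and
`y`. -/
theorem Beyond.unique (ha : G.IsAcyclic) {m x y v : V} (hx : G.Adj m x) (hy : G.Adj m y)
    (hxv : Beyond G m x v) (hyv : Beyond G m y v) : x = y := by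
  by_contra hne
  have h := reachable_deleteEdges_of_not_reachable (G.deleteEdges_le _) y hxv
    (not_beyond_self ha hx)
  refine not_reachable_deleteEdges ha hy ?_
  refine SimpleGraph.Reachable.trans (SimpleGraph.Adj.reachable ?_) (h.trans hyv.symm)
  rw [SimpleGraph.deleteEdges_adj]
  refine ⟨hx, fun he => hne ?_⟩
  have : x = y ∨ m = y ∧ x = m := by simpa using he
  grind

theorem exists_beyond (hc : G.Preconnected) {m v : V} (hne : v ≠ m) :
    ∃ x, G.Adj m x ∧ Beyond G m x v := by
  obtain ⟨w⟩ := hc v m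
  induction w with
  | nil => exact absurd rfl hne
  | @cons u w v huw p ih =>
    by_cases hw : w = v
    · subst hw
      exact ⟨u, huw.symm, .rfl⟩
    · obtain ⟨x, hx, hxw⟩ := ih hw
      refine ⟨x, hx, hxw.trans (SimpleGraph.Adj.reachable ?_)⟩
      rw [SimpleGraph.deleteEdges_adj]
      refine ⟨huw.symm, fun he => ?_⟩
      have hmem : v ∈ s(w, u) := by rw [Set.mem_singleton_iff.1 he]; simp
      rcases Sym2.mem_iff.1 hmem with rfl | rfl
      · exact hw rfl
      · exact hne rfl

/-- Here `x` points from `m` towards `n`, and `y` from `n` towards `m`; whatever is not on the side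
of `n` is seen from `n` through `m`. -/
theorem exists_beyond_or_beyond (hc : G.Preconnected) (ha : G.IsAcyclic) {m n : V} (hne : m ≠ n) :
    ∃ x y, G.Adj m x ∧ G.Adj n y ∧ ∀ v, Beyond G m x v ∨ Beyond G n y v := by
  obtain ⟨x, hx, hxn⟩ := exists_beyond hc hne.symm
  obtain ⟨y, hy, hym⟩ := exists_beyond hc hne
  refine ⟨x, y, hx, hy, fun v => (beyond_or_beyond hc m x v).imp_right fun hv => ?_⟩
  exact hym.trans (reachable_deleteEdges_of_not_reachable (G.deleteEdges_le _) y hv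
    (hxn.not_swap ha hx))

/-- The size of this set is the decreasing measure for moving through the tree away from `m`. -/
theorem beyond_ssubset (ha : G.IsAcyclic) {m x y : V} (hy : G.Adj x y)
    (hne : y ≠ m) : {v | Beyond G x y v} ⊂ {v | Beyond G m x v} := by
  refine Set.ssubset_iff_of_subset (fun v hv => ?_) |>.2 ⟨x, .rfl, not_beyond_self ha hy⟩
  have h := reachable_deleteEdges_of_not_reachable (G.deleteEdges_le _) m hv
    (not_beyond_self ha hy)
  rw [Sym2.eq_swap] at h
  refine SimpleGraph.Reachable.trans (SimpleGraph.Adj.reachable ?_) h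
  rw [SimpleGraph.deleteEdges_adj]
  refine ⟨hy, fun he => hne ?_⟩
  have : x = m ∧ y = x ∨ y = m := by simpa using he
  grind

end Tree

/-! ### Leaves and edges of a PQ-tree -/

namespace PQTree

variable {L : Type} (T : PQTree L)

theorem exists_belongs (μ : T.Inner) (l : L) : ∃ e, T.Belongs μ e l := by
  obtain ⟨x, hx, h⟩ := exists_beyond T.preconnected (m := inr μ) (v := inl l) (by simp)
  exact ⟨⟨x, hx⟩, h⟩

variable {T}

theorem Belongs.unique {μ : T.Inner} {e e' : T.Edge μ} {l : L} (h : T.Belongs μ e l)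
    (h' : T.Belongs μ e' l) : e = e' :=
  Subtype.ext (Beyond.unique T.acyclic e.2 e'.2 h h')

variable (T)

/-- The edge incident to `μ` to which the leaf `l` belongs. -/
noncomputable def edge (μ : T.Inner) (l : L) : T.Edge μ := (T.exists_belongs μ l).choose

theorem belongs_edge (μ : T.Inner) (l : L) : T.Belongs μ (T.edge μ l) l :=
  (T.exists_belongs μ l).choose_spec

theorem belongs_iff {μ : T.Inner} {e : T.Edge μ} {l : L} : T.Belongs μ e l ↔ T.edge μ l = e :=
  ⟨fun h => (T.belongs_edge μ l).unique h, fun h => h ▸ T.belongs_edge μ l⟩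

theorem separates_iff {μ : T.Inner} {a b c : L} : T.Separates μ a b c ↔
    T.edge μ a ≠ T.edge μ b ∧ T.edge μ b ≠ T.edge μ c ∧ T.edge μ a ≠ T.edge μ c := by
  simp only [Separates, belongs_iff]
  constructor
  · rintro ⟨_, _, _, h₁, h₂, h₃, rfl, rfl, rfl⟩
    exact ⟨h₁, h₂, h₃⟩
  · rintro ⟨h₁, h₂, h₃⟩
    exact ⟨_, _, _, h₁, h₂, h₃, rfl, rfl, rfl⟩

theorem exists_edge_or_edge {μ ν : T.Inner} (h : μ ≠ ν) :
    ∃ x y, ∀ l, T.edge μ l = x ∨ T.edge ν l = y := by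
  obtain ⟨x, y, hx, hy, H⟩ := exists_beyond_or_beyond T.preconnected T.acyclic
    (m := inr μ) (n := inr ν) (by simpa using h)
  exact ⟨⟨x, hx⟩, ⟨y, hy⟩, fun l => (H (inl l)).imp T.belongs_iff.1 T.belongs_iff.1⟩

variable {T} in
-- If `μ ≠ ν`, every leaf is in direction `x` from `μ` or `y` from `ν`, but each direction admits
-- only one of three separated leaves.
theorem Separates.unique {μ ν : T.Inner} {a b c : L} (h : T.Separates μ a b c)
    (h' : T.Separates ν a b c) : μ = ν := by
  by_contra hne
  obtain ⟨x, y, H⟩ := T.exists_edge_or_edge hne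
  rw [separates_iff] at h h'
  have ha := H a
  have hb := H b
  have hc := H c
  grind

theorem finite_edge [Finite L] (μ : T.Inner) : Finite (T.Edge μ) := by
  have := T.finite_inner
  infer_instance

/-- An inner node has a neighbour other than the one just left, so moving away from `m` can stop
only at a leaf. -/
theorem exists_leaf_beyond [Finite L] {m x : L ⊕ T.Inner} (h : T.G.Adj m x) :
    ∃ l, Beyond T.G m x (inl l) := by
  have := T.finite_inner
  induction hn : {v | Beyond T.G m x v}.ncard using Nat.strong_induction_on generalizing m x with
  | _ n ih =>
    rcases x with l | ν
    · exact ⟨l, .rfl⟩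
    · obtain ⟨y, hy, hne⟩ : ∃ y ∈ T.G.neighborSet (inr ν), y ≠ m := by
        refine Set.exists_ne_of_one_lt_encard ?_ m
        exact lt_of_lt_of_le (by norm_num) (T.inner_deg ν)
      have hss := beyond_ssubset T.acyclic hy hne
      obtain ⟨l, hl⟩ := ih _ (hn ▸ Set.ncard_lt_ncard hss (Set.toFinite _)) hy rfl
      exact ⟨l, hss.subset hl⟩

theorem exists_edge_eq [Finite L] {μ : T.Inner} (e : T.Edge μ) : ∃ l, T.edge μ l = e := by
  obtain ⟨l, hl⟩ := T.exists_leaf_beyond e.2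
  exact ⟨l, T.belongs_iff.1 hl⟩

/-- Move towards `b` and `c`, leaving `a` behind, until the two part ways. This happens before a
leaf is reached, because only that leaf itself lies beyond its edge. -/
theorem exists_separates_of_beyond [Finite L] {a b c : L} (hbc : b ≠ c) {u x : L ⊕ T.Inner}
    (h : T.G.Adj u x) (ha : ¬ Beyond T.G u x (inl a)) (hb : Beyond T.G u x (inl b))
    (hc : Beyond T.G u x (inl c)) : ∃ μ, T.Separates μ a b c := by
  have := T.finite_inner
  induction hn : {v | Beyond T.G u x v}.ncard using Nat.strong_induction_on generalizing u x with
  | _ n ih =>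
    rcases x with l | ν
    · have key : ∀ d, Beyond T.G u (inl l) (inl d) → d = l := by
        intro d hd
        by_contra hne
        obtain ⟨y, hy, hyd⟩ := exists_beyond T.preconnected (m := inl l) (v := inl d)
          (by simpa using hne)
        obtain rfl : y = u := T.leaf_deg l hy h.symm
        exact hd.not_swap T.acyclic h hyd
      exact absurd ((key b hb).trans (key c hc).symm) hbc
    · have hu : T.edge ν a = ⟨u, h.symm⟩ :=
        T.belongs_iff.1 ((beyond_or_beyond T.preconnected u (inr ν) (inl a)).resolve_left ha)
      have key : ∀ d, Beyond T.G u (inr ν) (inl d) → T.edge ν a ≠ T.edge ν d := by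
        intro d hd he
        rw [hu, eq_comm, ← belongs_iff] at he
        exact hd.not_swap T.acyclic h he
      by_cases hy : T.edge ν b = T.edge ν c
      · have hne : (T.edge ν b).1 ≠ u := fun he => key b hb (by rw [hu]; exact Subtype.ext he.symm)
        have hss := beyond_ssubset T.acyclic (T.edge ν b).2 hne
        refine ih _ (hn ▸ Set.ncard_lt_ncard hss (Set.toFinite _)) (T.edge ν b).2
          (fun he => ?_) (T.belongs_edge ν b) ?_ rfl
        · exact key b hb (T.belongs_iff.1 he)
        · rw [hy]
          exact T.belongs_edge ν c
      · exact ⟨ν, T.separates_iff.2 ⟨key b hb, hy, key c hc⟩⟩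

theorem exists_separates [Finite L] {a b c : L} (hab : a ≠ b) (hbc : b ≠ c) (hac : a ≠ c) :
    ∃ μ, T.Separates μ a b c := by
  obtain ⟨x, hx, hb⟩ := exists_beyond T.preconnected (m := inl a) (v := inl b)
    (by simpa using hab.symm)
  obtain ⟨y, hy, hc⟩ := exists_beyond T.preconnected (m := inl a) (v := inl c)
    (by simpa using hac.symm)
  obtain rfl := T.leaf_deg a hx hy
  exact T.exists_separates_of_beyond hbc hx (not_beyond_self T.acyclic hx) hb hc

theorem exists_three_edges (μ : T.Inner) : ∃ x y z : T.Edge μ, x ≠ y ∧ y ≠ z ∧ x ≠ z := by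
  have h := T.inner_deg μ
  obtain ⟨t, ht, hc⟩ := Set.exists_subset_encard_eq h
  obtain ⟨x, y, z, hxy, hxz, hyz, rfl⟩ := Set.encard_eq_three.1 hc
  refine ⟨⟨x, ht (by simp)⟩, ⟨y, ht (by simp)⟩, ⟨z, ht (by simp)⟩, ?_⟩
  simp [hxy, hxz, hyz]

theorem exists_separates_at [Finite L] (μ : T.Inner) : ∃ a b c, T.Separates μ a b c := by
  obtain ⟨x, y, z, hxy, hyz, hxz⟩ := T.exists_three_edges μ
  obtain ⟨a, rfl⟩ := T.exists_edge_eq x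
  obtain ⟨b, rfl⟩ := T.exists_edge_eq y
  obtain ⟨c, rfl⟩ := T.exists_edge_eq z
  exact ⟨a, b, c, T.separates_iff.2 ⟨hxy, hyz, hxz⟩⟩

end PQTree

/-! ### Construction of circular orders -/

/-- The circular order with a given strict betweenness relation. -/
@[reducible]
def circularOrderOfSBtw {α : Type} (s : α → α → α → Prop) (cyc : ∀ a b c, s a b c → s b c a)
    (asymm : ∀ a b c, s a b c → ¬ s c b a)
    (trans : ∀ a b c d, s a b c → s b d c → s a d c)
    (total : ∀ a b c, a ≠ b → b ≠ c → c ≠ a → s a b c ∨ s c b a) : CircularOrder α where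
  btw a b c := ¬ s c b a
  sbtw := s
  btw_refl a h := asymm _ _ _ h h
  btw_cyclic_left h h' := h (cyc _ _ _ (h'))
  sbtw_iff_btw_not_btw := by
    intro a b c
    exact ⟨fun h => ⟨asymm _ _ _ h, not_not_intro h⟩, fun h => not_not.1 h.2⟩
  sbtw_trans_left h h' := trans _ _ _ _ h h'
  btw_antisymm := by
    intro a b c h h'
    by_contra! hne
    exact (total a b c hne.1 hne.2.1 hne.2.2).elim h' h
  btw_total a b c := by
    by_contra! h
    exact asymm _ _ _ h.1 h.2

section CircularOrder

variable {α β : Type}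

theorem sbtw_ne (O : CircularOrder α) {a b c : α} (h : O.sbtw a b c) : a ≠ b ∧ b ≠ c ∧ a ≠ c := by
  refine ⟨?_, ?_, ?_⟩ <;> rintro rfl
  · exact sbtw_irrefl_left h
  · exact sbtw_irrefl_right h
  · exact sbtw_irrefl_left_right h

theorem sbtw_total (O : CircularOrder α) {a b c : α} (hab : a ≠ b) (hbc : b ≠ c) (hac : a ≠ c) :
    O.sbtw a b c ∨ O.sbtw c b a := by
  rw [sbtw_iff_not_btw, sbtw_iff_not_btw, ← not_and_or]
  rintro ⟨h, h'⟩
  rcases O.btw_antisymm h h' with h | h | h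
  · exact hbc h.symm
  · exact hab h.symm
  · exact hac h

theorem sbtw_rev_iff (O : CircularOrder α) {a b c : α} (hab : a ≠ b) (hbc : b ≠ c) (hac : a ≠ c) :
    O.sbtw c b a ↔ ¬ O.sbtw a b c :=
  ⟨fun h h' => sbtw_asymm h h', (sbtw_total O hab hbc hac).resolve_left⟩

/-- The reversal of a circular order. -/
@[reducible]
def reverseOrder (O : CircularOrder α) : CircularOrder α :=
  circularOrderOfSBtw (fun a b c => O.sbtw c b a)
    (fun _ _ _ h => sbtw_cyclic_right h)
    (fun _ _ _ h => sbtw_asymm h)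
    (fun _ _ _ _ h h' => sbtw_trans_right h' h)
    (fun _ _ _ h h' h'' => (sbtw_total O h h' h''.symm).symm)

/-- The circular order induced by an injective map. -/
@[reducible]
def comapOrder (O : CircularOrder α) (f : β → α) (hf : Function.Injective f) : CircularOrder β :=
  circularOrderOfSBtw (fun a b c => O.sbtw (f a) (f b) (f c))
    (fun _ _ _ h => sbtw_cyclic_left h)
    (fun _ _ _ h => sbtw_asymm h)
    (fun _ _ _ _ h h' => O.sbtw_trans_left h h')
    (fun _ _ _ h h' h'' => sbtw_total O (hf.ne h) (hf.ne h') (hf.ne h''.symm))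

end CircularOrder

theorem nonempty_circularOrder (α : Type) [Finite α] : Nonempty (CircularOrder α) := by
  obtain ⟨n, ⟨e⟩⟩ := Finite.exists_equiv_fin α
  exact ⟨comapOrder (LinearOrder.toCircularOrder (Fin n)) e e.injective⟩

/-- Some circular order separates the pair `a`, `d` by the pair `b`, `c`. -/
theorem exists_sbtw_not_sbtw {α : Type} [Finite α] {a b c d : α} (hab : a ≠ b) (hbc : b ≠ c)
    (hac : a ≠ c) (hda : d ≠ a) (hdb : d ≠ b) (hdc : d ≠ c) :
    ∃ O : CircularOrder α, O.sbtw a b c ∧ ¬ O.sbtw d b c := by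
  classical
  by_contra! H
  have key : ∀ (O : CircularOrder α) (π : Equiv.Perm α), O.sbtw (π a) (π b) (π c) →
      O.sbtw (π d) (π b) (π c) := fun O π h => H (comapOrder O π π.injective) h
  have main : ∀ O : CircularOrder α, ¬ O.sbtw a b c := by
    intro O h₁
    have h₂ := H O h₁
    have h₃ : O.sbtw d c a := by
      -- The two products are the cyclic shifts of `a`, `b`, `c`, with `d` left in place. The
      -- assumed implication thus puts `d` into all three gaps of the cycle at once.
      have := key O (Equiv.swap a b * Equiv.swap b c)
      simp only [Equiv.Perm.mul_apply, Equiv.swap_apply_def] at this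
      simp only [hab, hac, hbc, hda, hdb, hdc, hab.symm, hac.symm, hbc.symm, if_true, if_false]
        at this
      exact this (sbtw_cyclic_left h₁)
    have h₄ : O.sbtw d a b := by
      have := key O (Equiv.swap b c * Equiv.swap a b)
      simp only [Equiv.Perm.mul_apply, Equiv.swap_apply_def] at this
      simp only [hab, hac, hbc, hda, hdb, hdc, hab.symm, hac.symm, hbc.symm, if_true, if_false]
        at this
      exact this (sbtw_cyclic_right h₁)
    exact sbtw_asymm (sbtw_trans_right h₂ h₃) (sbtw_cyclic_left h₄)
  obtain ⟨O⟩ := nonempty_circularOrder α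
  exact (sbtw_total O hab hbc hac).elim (main O) (main (reverseOrder O))

/-! ### Orders represented by a PQ-tree -/

namespace PQTree

variable {L : Type} (T : PQTree L)

/-- A choice of circular orders around the inner nodes that respects the Q-nodes. -/
def IsEmbedding (σ : ∀ μ : T.Inner, CircularOrder (T.Edge μ)) : Prop :=
  ∀ (μ : T.Inner) (c : CircularOrder (T.Edge μ)), T.kind μ = some c →
    (∀ x y z, (σ μ).sbtw x y z ↔ c.sbtw x y z) ∨ (∀ x y z, (σ μ).sbtw x y z ↔ c.sbtw z y x)

/-- The order `O` of the leaves is the one of the embedding `σ`. -/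
def Induces (σ : ∀ μ : T.Inner, CircularOrder (T.Edge μ)) (O : CircularOrder L) : Prop :=
  ∀ μ a b c, T.Separates μ a b c →
    (O.sbtw a b c ↔ (σ μ).sbtw (T.edge μ a) (T.edge μ b) (T.edge μ c))

theorem represents_iff {O : CircularOrder L} :
    T.Represents O ↔ ∃ σ, T.IsEmbedding σ ∧ T.Induces σ O := by
  refine exists_congr fun σ => and_congr_right fun _ => ?_
  simp only [Induces, separates_iff, belongs_iff]
  constructor
  · intro h μ a b c hs
    exact h μ _ _ _ a b c hs.1 hs.2.1 hs.2.2 rfl rfl rfl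
  · rintro h μ _ _ _ a b c h₁ h₂ h₃ rfl rfl rfl
    exact h μ a b c ⟨h₁, h₂, h₃⟩

variable {T} in
theorem Separates.rotate {μ : T.Inner} {a b c : L} (h : T.Separates μ a b c) :
    T.Separates μ b c a := by
  rw [separates_iff] at *
  exact ⟨h.2.1, h.2.2.symm, h.1.symm⟩

variable {T} in
theorem Separates.swap {μ : T.Inner} {a b c : L} (h : T.Separates μ a b c) :
    T.Separates μ c b a := by
  rw [separates_iff] at *
  exact ⟨h.2.1.symm, h.1.symm, h.2.2.symm⟩

/-- Any three distinct leaves are ordered at the unique node that separates them. Only transitivity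
involves two nodes. -/
theorem exists_induces [Finite L] (σ : ∀ μ : T.Inner, CircularOrder (T.Edge μ)) :
    ∃ O, T.Induces σ O := by
  refine ⟨circularOrderOfSBtw (fun a b c => ∃ μ, T.Separates μ a b c ∧
    (σ μ).sbtw (T.edge μ a) (T.edge μ b) (T.edge μ c)) ?_ ?_ ?_ ?_, ?_⟩
  · rintro a b c ⟨μ, h, h'⟩
    exact ⟨μ, h.rotate, sbtw_cyclic_left h'⟩
  · rintro a b c ⟨μ, h, h'⟩ ⟨ν, k, k'⟩
    obtain rfl := h.unique k.swap
    exact sbtw_asymm h' k'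
  · rintro a b c d ⟨μ, h, h'⟩ ⟨ν, k, k'⟩
    by_cases hne : μ = ν
    · subst hne
      have := (σ μ).sbtw_trans_left h' k'
      have hd := sbtw_ne _ this
      exact ⟨μ, T.separates_iff.2 hd, this⟩
    · obtain ⟨x, y, H⟩ := T.exists_edge_or_edge hne
      have hA := H a
      have hB := H b
      have hC := H c
      have hD := H d
      rw [separates_iff] at h k
      -- At most one of `b`, `d`, `c` is not in direction `x` from `μ`, and at most one of `a`, `b`,
      -- `c` is. So `d` and one of `b`, `c` are; if it is `c`, then `a` and `b` share direction `y`
      -- at `ν`.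
      have : T.edge μ b = T.edge μ d ∨ T.edge ν b = T.edge ν a := by grind
      rcases this with h | h
      · rw [h] at h'
        exact ⟨μ, T.separates_iff.2 (sbtw_ne _ h'), h'⟩
      · rw [h] at k'
        exact ⟨ν, T.separates_iff.2 (sbtw_ne _ k'), k'⟩
  · intro a b c hab hbc hca
    obtain ⟨μ, h⟩ := T.exists_separates hab hbc hca.symm
    have hs := T.separates_iff.1 h
    exact (sbtw_total (σ μ) hs.1 hs.2.1 hs.2.2).imp (⟨μ, h, ·⟩) (⟨μ, h.swap, ·⟩)
  · intro μ a b c h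
    refine ⟨?_, fun h' => ⟨μ, h, h'⟩⟩
    rintro ⟨ν, k, k'⟩
    obtain rfl := h.unique k
    exact k'

theorem exists_isEmbedding [Finite L] : ∃ σ, T.IsEmbedding σ := by
  have := T.finite_edge
  refine ⟨fun μ => (T.kind μ).getD (nonempty_circularOrder _).some, fun μ c h => .inl fun x y z => ?_⟩
  beta_reduce
  rw [h]

variable {T} in
open Classical in
theorem IsEmbedding.update {σ : ∀ μ : T.Inner, CircularOrder (T.Edge μ)} (hσ : T.IsEmbedding σ)
    {μ : T.Inner} (hμ : T.IsP μ) (O : CircularOrder (T.Edge μ)) :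
    T.IsEmbedding (Function.update σ μ O) := by
  intro ν c hc
  have hne : ν ≠ μ := by
    rintro rfl
    rw [IsP] at hμ
    simp [hμ] at hc
  rw [Function.update_of_ne hne]
  exact hσ ν c hc

/-- At a P-node, the position of `a` with respect to the leaves `b` and `c`, which belong to two
other edges, is independent of the position of any leaf `d ≠ c` that belongs to an edge
different from those of `a` and `b`. -/
theorem exists_represents_sbtw [Finite L] {μ : T.Inner} (hμ : T.IsP μ) {a b c d : L}
    (h : T.Separates μ a b c) (hda : T.edge μ d ≠ T.edge μ a) (hdb : T.edge μ d ≠ T.edge μ b)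
    (hne : d ≠ c) : ∃ O, T.Represents O ∧ ¬ (O.sbtw a b c ↔ O.sbtw d b c) := by
  classical
  have := T.finite_edge μ
  obtain ⟨σ, hσ⟩ := T.exists_isEmbedding
  have hs := T.separates_iff.1 h
  -- If `d` and `c` share an edge, then `d`, `b`, `c` are ordered at another node, and reversing the
  -- order at `μ` affects only `a`, `b`, `c`. Otherwise four different edges at `μ` can be ordered
  -- as desired.
  by_cases hdc : T.edge μ d = T.edge μ c
  · obtain ⟨ν, hν⟩ := T.exists_separates (a := d) (b := b) (c := c)
      (fun he => hdb (he ▸ rfl)) (fun he => hs.2.1 (he ▸ rfl)) hne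
    have hνμ : ν ≠ μ := by
      rintro rfl
      exact (T.separates_iff.1 hν).2.2 hdc
    obtain ⟨O'⟩ := nonempty_circularOrder (T.Edge μ)
    by_contra! H
    obtain ⟨O₁, h₁⟩ := T.exists_induces (Function.update σ μ O')
    obtain ⟨O₂, h₂⟩ := T.exists_induces (Function.update σ μ (reverseOrder O'))
    have k₁ := H O₁ (T.represents_iff.2 ⟨_, hσ.update hμ O', h₁⟩)
    have k₂ := H O₂ (T.represents_iff.2 ⟨_, hσ.update hμ _, h₂⟩)
    rw [h₁ μ a b c h, h₁ ν d b c hν, Function.update_of_ne hνμ, Function.update_self] at k₁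
    rw [h₂ μ a b c h, h₂ ν d b c hν, Function.update_of_ne hνμ, Function.update_self] at k₂
    have := sbtw_rev_iff O' hs.1 hs.2.1 hs.2.2
    exact iff_not_self ((k₁.trans k₂.symm).trans this)
  · obtain ⟨O', h₁, h₂⟩ := exists_sbtw_not_sbtw hs.1 hs.2.1 hs.2.2 hda hdb hdc
    obtain ⟨O, hO⟩ := T.exists_induces (Function.update σ μ O')
    refine ⟨O, T.represents_iff.2 ⟨_, hσ.update hμ O', hO⟩, fun hi => h₂ ?_⟩
    rw [hO μ a b c h, hO μ d b c (T.separates_iff.2 ⟨hdb, hs.2.1, hdc⟩),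
      Function.update_self] at hi
    exact hi.1 h₁

/-! ### Normalized arcs -/

/-- If every order represented by `T'` extends to one represented by `T`, then all leaves that
belong to three different edges at a P-node of `T'` belong to three different edges
at the same node of `T`, as soon as this is so for some of them. -/
theorem Separates.replace {L' : Type} [Finite L'] {T' : PQTree L'} {f : L' → L}
    (H : ∀ O', T'.Represents O' → ∃ O, T.Represents O ∧ IsSuborder f O' O)
    {p : T'.Inner} (hp : T'.IsP p) {q : T.Inner} {a b c d : L'} (h : T'.Separates p a b c)
    (hq : T.Separates q (f a) (f b) (f c)) (h' : T'.Separates p a b d) :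
    T.Separates q (f a) (f b) (f d) := by
  -- If `f d` shared the edge of `f a` at `q`, both would have the same position relative to `f b`
  -- and `f c` in every order of `T`, against the freedom at the P-node `p`.
  have key : ∀ a b, T'.Separates p a b c → T.Separates q (f a) (f b) (f c) →
      T'.Separates p a b d → T.edge q (f d) ≠ T.edge q (f a) := by
    intro a b h hq h' he
    rw [separates_iff] at h' hq
    have hne : d ≠ c := by
      rintro rfl
      exact hq.2.2 he.symm
    obtain ⟨O', hO', hn⟩ := T'.exists_represents_sbtw hp h h'.2.2.symm h'.2.1.symm hne
    obtain ⟨O, hO, hsub⟩ := H O' hO'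
    obtain ⟨σ, -, hσ⟩ := T.represents_iff.1 hO
    apply hn
    rw [hsub, hsub, hσ q _ _ _ (T.separates_iff.2 hq),
      hσ q (f d) (f b) (f c) (T.separates_iff.2 ⟨he ▸ hq.1, hq.2.1, he ▸ hq.2.2⟩), he]
  rw [separates_iff]
  exact ⟨(T.separates_iff.1 hq).1, (key b a h.swap.rotate hq.swap.rotate h'.swap.rotate).symm,
    (key a b h hq h').symm⟩

/-- Any leaf `m` can be exchanged into the given triple, in place of the leaf on its edge at `p` if
there is one. A second exchange brings in any `n` on an edge other than that of `m`. -/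
theorem Separates.of_separates {L' : Type} [Finite L'] {T' : PQTree L'} {f : L' → L}
    (H : ∀ O', T'.Represents O' → ∃ O, T.Represents O ∧ IsSuborder f O' O)
    {p : T'.Inner} (hp : T'.IsP p) {q : T.Inner} {a b c : L'} (h : T'.Separates p a b c)
    (hq : T.Separates q (f a) (f b) (f c)) {a' b' c' : L'} (h' : T'.Separates p a' b' c') :
    T.Separates q (f a') (f b') (f c') := by
  have step : ∀ m, ∃ a b, T'.Separates p a b m ∧ T.Separates q (f a) (f b) (f m) := by
    intro m
    have hs := T'.separates_iff.1 h
    by_cases ha : T'.edge p m = T'.edge p a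
    · exact ⟨b, c, T'.separates_iff.2 (by grind), Separates.replace T H hp h.rotate hq.rotate
        (T'.separates_iff.2 (by grind))⟩
    · by_cases hb : T'.edge p m = T'.edge p b
      · exact ⟨c, a, T'.separates_iff.2 (by grind), Separates.replace T H hp h.rotate.rotate
          hq.rotate.rotate (T'.separates_iff.2 (by grind))⟩
      · exact ⟨a, b, T'.separates_iff.2 (by grind), Separates.replace T H hp h hq
          (T'.separates_iff.2 (by grind))⟩
  have key : ∀ m n, T'.edge p m ≠ T'.edge p n → T.edge q (f m) ≠ T.edge q (f n) := by
    intro m n hmn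
    obtain ⟨x, y, hxy, hq⟩ := step m
    have hs := T'.separates_iff.1 hxy
    by_cases hx : T'.edge p n = T'.edge p x
    · have := Separates.replace T H hp hxy.rotate hq.rotate (d := n)
        (T'.separates_iff.2 (by grind))
      exact (T.separates_iff.1 this).2.1
    · have := Separates.replace T H hp hxy.swap.rotate.swap hq.swap.rotate.swap (d := n)
        (T'.separates_iff.2 (by grind))
      rw [separates_iff] at this
      grind
  rw [separates_iff] at h' ⊢
  exact ⟨key _ _ h'.1, key _ _ h'.2.1, key _ _ h'.2.2⟩

end PQTree

/-! ### P-nodes and arcs -/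

namespace PQGraph

variable {D : PQGraph}

/-- Leaves of the target of `a`, seen as leaves of its source, belong to three different edges
at the P-node `q` of the source. -/
def SepSrc (q : D.PNode) (a : D.Arc) (l₁ l₂ l₃ : D.Leaf (D.tgt a)) : Prop :=
  ∃ h : D.src a = q.node,
    q.T.Separates q.μ (h ▸ D.map a l₁) (h ▸ D.map a l₂) (h ▸ D.map a l₃)

/-- Leaves of the target of `a` belong to three different edges at the P-node `p` of the target. -/
def SepTgt (p : D.PNode) (a : D.Arc) (l₁ l₂ l₃ : D.Leaf (D.tgt a)) : Prop :=
  ∃ h : D.tgt a = p.node, p.T.Separates p.μ (h ▸ l₁) (h ▸ l₂) (h ▸ l₃)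

theorem sepSrc_mk {i : D.Node} {T : PQTree (D.Leaf i)} {hT : D.tree i = some T} {μ : T.Inner}
    {hμ : T.IsP μ} {a : D.Arc} {l₁ l₂ l₃ : D.Leaf (D.tgt a)} :
    SepSrc ⟨i, T, hT, μ, hμ⟩ a l₁ l₂ l₃ ↔ ∃ h : D.src a = i,
      T.Separates μ (h ▸ D.map a l₁) (h ▸ D.map a l₂) (h ▸ D.map a l₃) := Iff.rfl

theorem sepTgt_mk {i : D.Node} {T : PQTree (D.Leaf i)} {hT : D.tree i = some T} {μ : T.Inner}
    {hμ : T.IsP μ} {a : D.Arc} {l₁ l₂ l₃ : D.Leaf (D.tgt a)} :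
    SepTgt ⟨i, T, hT, μ, hμ⟩ a l₁ l₂ l₃ ↔ ∃ h : D.tgt a = i,
      T.Separates μ (h ▸ l₁) (h ▸ l₂) (h ▸ l₃) := Iff.rfl

variable (D) in
/-- If some leaves separated at a P-node of the target of an arc are separated at a
P-node of the source, then the former P-node stems from the latter. -/
def IsUniform : Prop :=
  ∀ (a : D.Arc) (p q : D.PNode) (l₁ l₂ l₃ : D.Leaf (D.tgt a)), SepTgt p a l₁ l₂ l₃ →
    SepSrc q a l₁ l₂ l₃ → D.Stems p a q

theorem stems_iff {p q : D.PNode} {a : D.Arc} : D.Stems p a q ↔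
    D.tgt a = p.node ∧ D.src a = q.node ∧
      ∀ l₁ l₂ l₃, SepTgt p a l₁ l₂ l₃ → SepSrc q a l₁ l₂ l₃ := by
  constructor
  · rintro ⟨h, h', H⟩
    exact ⟨h, h', fun l₁ l₂ l₃ ⟨_, hl⟩ => ⟨h', H l₁ l₂ l₃ hl⟩⟩
  · rintro ⟨h, h', H⟩
    exact ⟨h, h', fun l₁ l₂ l₃ hl => (H l₁ l₂ l₃ ⟨h, hl⟩).2⟩

theorem SepSrc.unique {q q' : D.PNode} {a : D.Arc} {l₁ l₂ l₃ : D.Leaf (D.tgt a)}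
    (h : SepSrc q a l₁ l₂ l₃) (h' : SepSrc q' a l₁ l₂ l₃) : q = q' := by
  obtain ⟨i, T, hT, μ, hμ⟩ := q
  obtain ⟨i', T', hT', μ', hμ'⟩ := q'
  obtain ⟨rfl, h⟩ := sepSrc_mk.1 h
  obtain ⟨rfl, h'⟩ := sepSrc_mk.1 h'
  obtain rfl : T = T' := Option.some.inj (hT.symm.trans hT')
  obtain rfl : μ = μ' := h.unique h'
  rfl

theorem Hits.unique {p : D.PNode} {a : D.Arc} {l : D.Leaf (D.tgt a)} {e e' : p.T.Edge p.μ}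
    (h : D.Hits p a l e) (h' : D.Hits p a l e') : e = e' :=
  h.2.unique h'.2

theorem sepSrc_iff_hits {p : D.PNode} {a : D.Arc} {l₁ l₂ l₃ : D.Leaf (D.tgt a)} :
    SepSrc p a l₁ l₂ l₃ ↔ ∃ e₁ e₂ e₃, e₁ ≠ e₂ ∧ e₂ ≠ e₃ ∧ e₁ ≠ e₃ ∧
      D.Hits p a l₁ e₁ ∧ D.Hits p a l₂ e₂ ∧ D.Hits p a l₃ e₃ := by
  constructor
  · rintro ⟨h, e₁, e₂, e₃, h₁, h₂, h₃, k₁, k₂, k₃⟩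
    exact ⟨e₁, e₂, e₃, h₁, h₂, h₃, ⟨h, k₁⟩, ⟨h, k₂⟩, ⟨h, k₃⟩⟩
  · rintro ⟨e₁, e₂, e₃, h₁, h₂, h₃, ⟨h, k₁⟩, ⟨_, k₂⟩, ⟨_, k₃⟩⟩
    exact ⟨h, e₁, e₂, e₃, h₁, h₂, h₃, k₁, k₂, k₃⟩

theorem fixes_iff {p : D.PNode} {a : D.Arc} :
    D.Fixes a p ↔ ∃ l₁ l₂ l₃, SepSrc p a l₁ l₂ l₃ := by
  constructor
  · intro h
    obtain ⟨t, ht, hc⟩ := Set.exists_subset_encard_eq h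
    obtain ⟨x, y, z, hxy, hxz, hyz, rfl⟩ := Set.encard_eq_three.1 hc
    obtain ⟨l₁, h₁⟩ := ht (show x ∈ _ by simp)
    obtain ⟨l₂, h₂⟩ := ht (show y ∈ _ by simp)
    obtain ⟨l₃, h₃⟩ := ht (show z ∈ _ by simp)
    exact ⟨l₁, l₂, l₃, sepSrc_iff_hits.2 ⟨x, y, z, hxy, hyz, hxz, h₁, h₂, h₃⟩⟩
  · rintro ⟨l₁, l₂, l₃, h⟩
    obtain ⟨x, y, z, hxy, hyz, hxz, h₁, h₂, h₃⟩ := sepSrc_iff_hits.1 h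
    have hc : ({x, y, z} : Set _).encard = 3 := Set.encard_eq_three.2 ⟨x, y, z, hxy, hxz, hyz, rfl⟩
    rw [Fixes, ← hc]
    refine Set.encard_le_encard ?_
    rintro e (rfl | rfl | rfl)
    exacts [⟨l₁, h₁⟩, ⟨l₂, h₂⟩, ⟨l₃, h₃⟩]

theorem SepSrc.ne {q : D.PNode} {a : D.Arc} {l₁ l₂ l₃ : D.Leaf (D.tgt a)}
    (h : SepSrc q a l₁ l₂ l₃) : D.map a l₁ ≠ D.map a l₂ ∧ D.map a l₂ ≠ D.map a l₃ ∧
      D.map a l₁ ≠ D.map a l₃ := by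
  obtain ⟨i, T, hT, μ, hμ⟩ := q
  obtain ⟨rfl, h⟩ := sepSrc_mk.1 h
  have h := T.separates_iff.1 h
  dsimp only at h
  refine ⟨fun he => h.1 ?_, fun he => h.2.1 ?_, fun he => h.2.2 ?_⟩ <;> rw [he]

theorem exists_sepTgt (hfin : ∀ i, Finite (D.Leaf i)) {p : D.PNode} {a : D.Arc}
    (h : D.tgt a = p.node) : ∃ l₁ l₂ l₃, SepTgt p a l₁ l₂ l₃ := by
  obtain ⟨i, T, hT, μ, hμ⟩ := p
  obtain rfl : D.tgt a = i := h
  have := hfin (D.tgt a)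
  obtain ⟨l₁, l₂, l₃, hl⟩ := T.exists_separates_at μ
  exact ⟨l₁, l₂, l₃, rfl, hl⟩

theorem Stems.fixes (hfin : ∀ i, Finite (D.Leaf i)) {p q : D.PNode} {a : D.Arc}
    (h : D.Stems p a q) : D.Fixes a q := by
  obtain ⟨ht, hs, H⟩ := stems_iff.1 h
  obtain ⟨l₁, l₂, l₃, hl⟩ := exists_sepTgt hfin ht
  exact fixes_iff.2 ⟨l₁, l₂, l₃, H _ _ _ hl⟩

theorem Stems.unique (hfin : ∀ i, Finite (D.Leaf i)) {p q q' : D.PNode} {a : D.Arc}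
    (h : D.Stems p a q) (h' : D.Stems p a q') : q = q' := by
  obtain ⟨ht, hs, H⟩ := stems_iff.1 h
  obtain ⟨-, -, H'⟩ := stems_iff.1 h'
  obtain ⟨l₁, l₂, l₃, hl⟩ := exists_sepTgt hfin ht
  exact (H _ _ _ hl).unique (H' _ _ _ hl)

/-- Uniformity of a single arc follows from normalization. -/
theorem stems_of_normalized (hfin : ∀ i, Finite (D.Leaf i)) {a : D.Arc}
    (H : ∀ O' ∈ orders (D.tree (D.tgt a)), ∃ O ∈ orders (D.tree (D.src a)),
      IsSuborder (D.map a) O' O) {p q : D.PNode} {l₁ l₂ l₃ : D.Leaf (D.tgt a)}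
    (hp : SepTgt p a l₁ l₂ l₃) (hq : SepSrc q a l₁ l₂ l₃) : D.Stems p a q := by
  obtain ⟨i, T, hT, μ, hμ⟩ := p
  obtain ⟨i', T', hT', μ', hμ'⟩ := q
  obtain ⟨rfl, hp⟩ := sepTgt_mk.1 hp
  obtain ⟨rfl, hq⟩ := sepSrc_mk.1 hq
  have := hfin (D.tgt a)
  rw [hT, hT'] at H
  exact ⟨rfl, rfl, fun _ _ _ h => PQTree.Separates.of_separates T' H hμ hp hq h⟩

/-! ### Trees that consist of a single P-node -/

theorem IsSinglePNode.unique {i : D.Node} (h : D.IsSinglePNode i) {p q : D.PNode}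
    (hp : p.node = i) (hq : q.node = i) : p = q := by
  obtain ⟨i, T, hT, μ, hμ⟩ := p
  obtain ⟨i', T', hT', μ', hμ'⟩ := q
  obtain ⟨T'', ν, hT'', -, hν⟩ := h
  dsimp only at hp hq
  subst hp hq
  obtain rfl : T = T' := Option.some.inj (hT.symm.trans hT')
  obtain rfl : T = T'' := Option.some.inj (hT.symm.trans hT'')
  obtain rfl : μ = μ' := (hν μ).trans (hν μ').symm
  rfl

theorem IsSinglePNode.separates (hfin : ∀ i, Finite (D.Leaf i)) {p : D.PNode}
    (h : D.IsSinglePNode p.node) {l₁ l₂ l₃ : D.Leaf p.node} (h₁ : l₁ ≠ l₂) (h₂ : l₂ ≠ l₃)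
    (h₃ : l₁ ≠ l₃) : p.T.Separates p.μ l₁ l₂ l₃ := by
  obtain ⟨T, ν, hT, -, hν⟩ := h
  obtain rfl : p.T = T := Option.some.inj (p.tree_eq.symm.trans hT)
  have := hfin p.node
  obtain ⟨ν', h⟩ := p.T.exists_separates h₁ h₂ h₃
  rwa [(hν p.μ).trans (hν ν').symm]

theorem IsSinglePNode.sepTgt (hfin : ∀ i, Finite (D.Leaf i)) {p : D.PNode} {a : D.Arc}
    (h : D.IsSinglePNode (D.tgt a)) (hp : D.tgt a = p.node) {l₁ l₂ l₃ : D.Leaf (D.tgt a)}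
    (h₁ : l₁ ≠ l₂) (h₂ : l₂ ≠ l₃) (h₃ : l₁ ≠ l₃) : SepTgt p a l₁ l₂ l₃ := by
  obtain ⟨i, T, hT, μ, hμ⟩ := p
  obtain rfl : D.tgt a = i := hp
  exact ⟨rfl, IsSinglePNode.separates (p := ⟨_, T, hT, μ, hμ⟩) hfin h h₁ h₂ h₃⟩

/-- A single P-node separates any three distinct leaves, in particular those witnessing that `q` is
fixed, so uniformity applies. -/
theorem IsSinglePNode.stems (hfin : ∀ i, Finite (D.Leaf i)) (hu : D.IsUniform) {p q : D.PNode}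
    {a : D.Arc} (h : D.IsSinglePNode (D.tgt a)) (hp : D.tgt a = p.node) (hq : D.Fixes a q) :
    D.Stems p a q := by
  obtain ⟨l₁, l₂, l₃, hl⟩ := fixes_iff.1 hq
  have hne := hl.ne
  refine hu a p q l₁ l₂ l₃ (h.sepTgt hfin hp ?_ ?_ ?_) hl
  · exact fun he => hne.1 (he ▸ rfl)
  · exact fun he => hne.2.1 (he ▸ rfl)
  · exact fun he => hne.2.2 (he ▸ rfl)

/-! ### Adding a node -/

section AddNode

variable {L : Type} {t : Option (PQTree L)} {a b : D.Arc} {f : L → D.Leaf (D.tgt a)}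
  {g : L → D.Leaf (D.tgt b)}

theorem PNode.addNode_injective :
    Function.Injective fun p : D.PNode => p.addNode t a b f g := by
  let F : (D.addNode t a b f g).PNode → Option D.PNode := fun
    | ⟨some i, T, hT, μ, hμ⟩ => some ⟨i, T, hT, μ, hμ⟩
    | ⟨none, _, _, _, _⟩ => none
  exact fun p q h => Option.some.inj (congrArg F h)

theorem exists_addNode_eq {p : (D.addNode t a b f g).PNode} {i : D.Node} (h : p.node = some i) :
    ∃ q : D.PNode, q.node = i ∧ q.addNode t a b f g = p := by
  obtain ⟨j, T, hT, μ, hμ⟩ := p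
  obtain rfl : j = some i := h
  exact ⟨⟨i, T, hT, μ, hμ⟩, rfl, rfl⟩

theorem sepSrc_addNode {p : D.PNode} {d : D.Arc} {l₁ l₂ l₃ : D.Leaf (D.tgt d)} :
    SepSrc (D := D.addNode t a b f g) (p.addNode t a b f g) (inl d) l₁ l₂ l₃ ↔
      SepSrc p d l₁ l₂ l₃ := by
  obtain ⟨i, T, hT, μ, hμ⟩ := p
  constructor
  · rintro ⟨h, hl⟩
    obtain rfl : D.src d = i := Option.some.inj h
    exact ⟨rfl, hl⟩
  · intro h
    obtain ⟨rfl, hl⟩ := sepSrc_mk.1 h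
    exact ⟨rfl, hl⟩

theorem sepTgt_addNode {p : D.PNode} {d : D.Arc} {l₁ l₂ l₃ : D.Leaf (D.tgt d)} :
    SepTgt (D := D.addNode t a b f g) (p.addNode t a b f g) (inl d) l₁ l₂ l₃ ↔
      SepTgt p d l₁ l₂ l₃ := by
  obtain ⟨i, T, hT, μ, hμ⟩ := p
  constructor
  · rintro ⟨h, hl⟩
    obtain rfl : D.tgt d = i := Option.some.inj h
    exact ⟨rfl, hl⟩
  · intro h
    obtain ⟨rfl, hl⟩ := sepTgt_mk.1 h
    exact ⟨rfl, hl⟩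

theorem fixes_addNode {p : D.PNode} {d : D.Arc} :
    (D.addNode t a b f g).Fixes (inl d) (p.addNode t a b f g) ↔ D.Fixes d p := by
  refine (fixes_iff (D := D.addNode t a b f g)).trans (Iff.trans ?_ fixes_iff.symm)
  exact exists_congr fun _ => exists_congr fun _ => exists_congr fun _ => sepSrc_addNode

theorem stems_addNode {p q : D.PNode} {d : D.Arc} :
    (D.addNode t a b f g).Stems (p.addNode t a b f g) (inl d) (q.addNode t a b f g) ↔
      D.Stems p d q := by
  refine (stems_iff (D := D.addNode t a b f g)).trans (Iff.trans ?_ stems_iff.symm)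
  refine and_congr Option.some_inj (and_congr Option.some_inj ?_)
  exact forall_congr' fun _ => forall_congr' fun _ => forall_congr' fun _ =>
    imp_congr sepTgt_addNode sepSrc_addNode

end AddNode

/-! ### Adding an arc -/

section AddArc

variable {i j : D.Node} {f : D.Leaf j → D.Leaf i}

theorem PNode.addArc_injective : Function.Injective fun p : D.PNode => p.addArc i j f := by
  let F : (D.addArc i j f).PNode → D.PNode := fun p => ⟨p.node, p.T, p.tree_eq, p.μ, p.isP⟩
  exact fun p q h => congrArg F h

theorem PNode.addArc_surjective : Function.Surjective fun p : D.PNode => p.addArc i j f :=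
  fun ⟨i, T, hT, μ, hμ⟩ => ⟨⟨i, T, hT, μ, hμ⟩, rfl⟩

theorem stems_addArc {p q : D.PNode} {d : D.Arc} :
    (D.addArc i j f).Stems (p.addArc i j f) (some d) (q.addArc i j f) ↔ D.Stems p d q := Iff.rfl

end AddArc

end PQGraph

open PQGraph

/-! ### The invariant of the expansion -/

namespace Stage

variable {E : Stage}

/-- The arcs that fix `p`, and those incoming arcs for which `p` stems from a P-node in `H` such that
no critical triple of this P-node and the arc has been processed. Every arc of the latter kind
may be traded in for an arc of the former kind, once. -/
def load (E : Stage) (H : Set E.PNode) (p : E.PNode) : Set (E.Arc ⊕ E.Arc × E.PNode) :=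
  inl '' {d | E.Fixes d p} ∪
    inr '' {s | E.Stems p s.1 s.2 ∧ s.2 ∈ H ∧ ∀ b, (s.2, s(s.1, b)) ∉ E.processed}

/-- The set `H` contains all P-nodes that are or may become part of a critical triple. -/
structure Invariant (E : Stage) (H : Set E.PNode) : Prop where
  finite_leaf : ∀ i, Finite (E.Leaf i)
  uniform : E.IsUniform
  critical : ∀ p a b, (p, s(a, b)) ∈ E.processed → E.IsCritical p a b
  load_le_two : ∀ p, (E.load H p).encard ≤ 2
  load_le_one : ∀ p ∉ H, (E.load H p).encard ≤ 1

variable {H : Set E.PNode}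

theorem mem_load_inl {p : E.PNode} {d : E.Arc} : inl d ∈ E.load H p ↔ E.Fixes d p := by
  simp [load]

theorem mem_load_inr {p : E.PNode} {d : E.Arc} {q : E.PNode} : inr (d, q) ∈ E.load H p ↔
    E.Stems p d q ∧ q ∈ H ∧ ∀ b, (q, s(d, b)) ∉ E.processed := by
  simp [load]

namespace Invariant

theorem mem_of_isCritical (h : E.Invariant H) {p : E.PNode} {a b : E.Arc}
    (hc : E.IsCritical p a b) : p ∈ H := by
  by_contra hp
  have := Set.encard_le_one_iff.1 (h.load_le_one p hp) _ _ (mem_load_inl.2 hc.2.1)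
    (mem_load_inl.2 hc.2.2)
  exact hc.1 (inl_injective this)

theorem eq_or_eq (h : E.Invariant H) {p : E.PNode} {a b c : E.Arc}
    (hc : E.IsCritical p a b) (hf : E.Fixes c p) : c = a ∨ c = b := by
  by_contra! hne
  have h3 : ({inl a, inl b, inl c} : Set (E.Arc ⊕ E.Arc × E.PNode)).encard = 3 :=
    Set.encard_eq_three.2 ⟨_, _, _, inl_injective.ne hc.1, inl_injective.ne hne.1.symm,
      inl_injective.ne hne.2.symm, rfl⟩
  have hsub : ({inl a, inl b, inl c} : Set (E.Arc ⊕ E.Arc × E.PNode)) ⊆ E.load H p := by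
    rintro _ (rfl | rfl | rfl)
    exacts [mem_load_inl.2 hc.2.1, mem_load_inl.2 hc.2.2, mem_load_inl.2 hf]
  have hle := (Set.encard_le_encard hsub).trans (h.load_le_two p)
  rw [h3] at hle
  exact absurd hle (by norm_num)

theorem atMostOneCritical (h : E.Invariant H) : E.AtMostOneCritical := by
  intro p a b a' b' hc hc'
  rcases h.eq_or_eq hc hc'.2.1 with rfl | rfl <;> rcases h.eq_or_eq hc hc'.2.2 with rfl | rfl
  · exact absurd rfl hc'.1
  · rfl
  · exact Sym2.eq_swap
  · exact absurd rfl hc'.1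

/-- No other triple with the same P-node is processed before a critical triple. -/
theorem unprocessed (h : E.Invariant H) {p : E.PNode} {a b : E.Arc} (hc : E.IsCritical p a b)
    (hu : (p, s(a, b)) ∉ E.processed) (c : E.Arc) : (p, s(a, c)) ∉ E.processed := by
  intro hp
  have hc' := h.critical _ _ _ hp
  rw [h.atMostOneCritical p a b a c hc hc'] at hu
  exact hu hp

/-- An arc from which `p` stems from the P-node of an unprocessed critical triple is in its load. -/
theorem mem_load (h : E.Invariant H) {p p₀ : E.PNode} {a b : E.Arc}
    (hc : E.IsCritical p₀ a b) (hu : (p₀, s(a, b)) ∉ E.processed) (hs : E.Stems p a p₀) :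
    inr (a, p₀) ∈ E.load H p :=
  mem_load_inr.2 ⟨hs, h.mem_of_isCritical hc, h.unprocessed hc hu⟩

end Invariant

end Stage

theorem PQGraph.IsCritical.symm {D : PQGraph} {p : D.PNode} {a b : D.Arc}
    (h : D.IsCritical p a b) : D.IsCritical p b a := ⟨h.1.symm, h.2.2, h.2.1⟩

theorem PQGraph.IsCritical.congr {D : PQGraph} {p : D.PNode} {a b a' b' : D.Arc}
    (h : D.IsCritical p a b) (he : s(a, b) = s(a', b')) : D.IsCritical p a' b' := by
  rcases Sym2.eq_iff.1 he with ⟨rfl, rfl⟩ | ⟨rfl, rfl⟩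
  exacts [h, h.symm]

/-! ### The invariant at the initial stage -/

namespace Instance

variable (D : Instance)

/-- The arc determines the P-node of the parent. Finiteness makes the `finsum` in the fixedness a
genuine sum. -/
theorem finite_stems (p : D.PNode) : Finite {s : D.Arc × D.PNode // D.Stems p s.1 s.2} := by
  have := D.finite_arc
  refine Finite.of_injective (fun s => s.1.1) ?_
  rintro ⟨⟨a, q⟩, h⟩ ⟨⟨a', q'⟩, h'⟩ rfl
  obtain rfl := h.unique D.finite_leaf h'
  rfl

theorem ncard_fixes_pos {p q : D.PNode} {a : D.Arc} (h : D.Stems p a q) :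
    (1 : ℤ) ≤ {a | D.Fixes a q}.ncard := by
  have := D.finite_arc
  have hne : {a | D.Fixes a q}.Nonempty := ⟨a, h.fixes D.finite_leaf⟩
  exact_mod_cast (Set.ncard_pos (Set.toFinite _)).2 hne

/-- All summands of the recursion are nonnegative: a P-node from which another one stems is fixed by
the connecting arc, so by induction its fixedness is at least 1. -/
theorem ncard_fixes_le_fixedness (p : D.PNode) :
    ({a | D.Fixes a p}.ncard : ℤ) ≤ D.fixedness p := by
  induction p using D.stemRel_wf.induction with
  | _ p ih =>
    rw [D.fixedness_eq p]
    refine le_add_of_nonneg_right (finsum_nonneg ?_)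
    rintro ⟨⟨a, q⟩, h⟩
    exact sub_nonneg.2 ((D.ncard_fixes_pos h).trans (ih q ⟨a, h⟩))

/-- A summand `fixedness q - 1` is 1 if `q` has fixedness 2 and 0 otherwise, so the recursion counts
the load. -/
theorem encard_load_le {D : Instance} (hD : D.IsFixed 2) (p : D.PNode) {k : ℕ}
    (hk : D.fixedness p ≤ k) :
    (D.initialStage.load {q : D.PNode | D.fixedness q = 2} p).encard ≤ k := by
  classical
  have := D.finite_arc
  have := D.finite_stems p
  have := Fintype.ofFinite {s : D.Arc × D.PNode // D.Stems p s.1 s.2}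
  let R : Finset {s : D.Arc × D.PNode // D.Stems p s.1 s.2} :=
    Finset.univ.filter fun s => D.fixedness s.1.2 = 2
  have hsum : ∑ᶠ s : {s : D.Arc × D.PNode // D.Stems p s.1 s.2}, (D.fixedness s.1.2 - 1) =
      (R.card : ℤ) := by
    rw [finsum_eq_sum_of_fintype, Finset.card_filter, Nat.cast_sum]
    refine Finset.sum_congr rfl ?_
    rintro ⟨⟨a, q⟩, h⟩ -
    have h₁ := (D.ncard_fixes_pos h).trans (D.ncard_fixes_le_fixedness q)
    have h₂ := hD q
    dsimp only
    split_ifs <;> push_cast <;> omega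
  rw [D.fixedness_eq, hsum] at hk
  have hle : ({a | D.Fixes a p}.ncard + R.card : ℕ) ≤ k := by exact_mod_cast hk
  refine (Set.encard_union_le _ _).trans (le_trans ?_ (Nat.cast_le.2 hle))
  rw [Nat.cast_add]
  refine add_le_add ?_ ?_
  · rw [Set.Finite.cast_ncard_eq (Set.toFinite _)]
    exact Set.encard_image_le _ _
  · refine (Set.encard_image_le _ _).trans ?_
    rw [← Set.encard_coe_eq_coe_finsetCard]
    refine le_trans (Set.encard_le_encard ?_) (Set.encard_image_le Subtype.val _)
    rintro s ⟨hs, hs', -⟩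
    have hm : (⟨s, hs⟩ : {s : D.Arc × D.PNode // D.Stems p s.1 s.2}) ∈ R :=
      Finset.mem_filter.2 ⟨Finset.mem_univ _, hs'⟩
    exact ⟨_, hm, rfl⟩

theorem initialStage_invariant {D : Instance} (hD : D.IsFixed 2) :
    D.initialStage.Invariant {q : D.PNode | D.fixedness q = 2} where
  finite_leaf := D.finite_leaf
  uniform _ _ _ _ _ _ := stems_of_normalized D.finite_leaf (D.normalized _)
  critical _ _ _ h := h.elim
  load_le_two p := encard_load_le hD p (hD p)
  load_le_one p hp := encard_load_le hD p (by
    have h := hD p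
    have hp : D.fixedness p ≠ 2 := hp
    push_cast
    omega)

end Instance

/-! ### Preservation of the invariant -/

section Expand

variable {E : Stage} {H : Set E.PNode} {p₀ : E.PNode} {a b : E.Arc}
  {t : Option (PQTree (E.CommonEdge p₀ a b))} {f : E.CommonEdge p₀ a b → E.Leaf (E.tgt a)}
  {g : E.CommonEdge p₀ a b → E.Leaf (E.tgt b)}

/-- The stage after an expansion step. -/
abbrev Stage.expand (E : Stage) (p₀ : E.PNode) (a b : E.Arc)
    (t : Option (PQTree (E.CommonEdge p₀ a b))) (f : E.CommonEdge p₀ a b → E.Leaf (E.tgt a))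
    (g : E.CommonEdge p₀ a b → E.Leaf (E.tgt b)) : Stage where
  toPQGraph := E.toPQGraph.addNode t a b f g
  expTree := insert none (some '' E.expTree)
  processed := (fun s => (s.1.addNode t a b f g, s.2.map inl)) ''
    insert (p₀, s(a, b)) E.processed

/-- Representatives of three common edges are separated at `p` and, lying on these different edges,
also at `p₀`; uniformity does the rest. -/
theorem stems_of_fixes_addNode (hu : E.IsUniform) (ht : E.IsExpansionTree p₀ a b t f g)
    {p : E.PNode} (hp : (E.addNode t a b f g).Fixes (inr false) (p.addNode t a b f g)) :
    E.Stems p a p₀ := by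
  obtain ⟨l₁, l₂, l₃, hl⟩ := (fixes_iff (D := E.addNode t a b f g)).1 hp
  have hne := hl.ne
  have hl' : SepTgt p a (f l₁) (f l₂) (f l₃) := by
    obtain ⟨i, T, hT, μ, hμ⟩ := p
    obtain ⟨h, hl⟩ := hl
    obtain rfl : E.tgt a = i := Option.some.inj h
    exact ⟨rfl, hl⟩
  refine hu a p p₀ _ _ _ hl' (sepSrc_iff_hits.2 ⟨l₁.1, l₂.1, l₃.1, ?_, ?_, ?_,
    ht.1 l₁, ht.1 l₂, ht.1 l₃⟩)
  · exact fun he => hne.1 (congrArg f (Subtype.ext he))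
  · exact fun he => hne.2.1 (congrArg f (Subtype.ext he))
  · exact fun he => hne.2.2 (congrArg f (Subtype.ext he))

theorem stems_of_fixes_addNode' (hu : E.IsUniform) (ht : E.IsExpansionTree p₀ a b t f g)
    {p : E.PNode} (hp : (E.addNode t a b f g).Fixes (inr true) (p.addNode t a b f g)) :
    E.Stems p b p₀ := by
  obtain ⟨l₁, l₂, l₃, hl⟩ := (fixes_iff (D := E.addNode t a b f g)).1 hp
  have hne := hl.ne
  have hl' : SepTgt p b (g l₁) (g l₂) (g l₃) := by
    obtain ⟨i, T, hT, μ, hμ⟩ := p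
    obtain ⟨h, hl⟩ := hl
    obtain rfl : E.tgt b = i := Option.some.inj h
    exact ⟨rfl, hl⟩
  refine hu b p p₀ _ _ _ hl' (sepSrc_iff_hits.2 ⟨l₁.1, l₂.1, l₃.1, ?_, ?_, ?_,
    ht.2.1 l₁, ht.2.1 l₂, ht.2.1 l₃⟩)
  · exact fun he => hne.1 (congrArg g (Subtype.ext he))
  · exact fun he => hne.2.1 (congrArg g (Subtype.ext he))
  · exact fun he => hne.2.2 (congrArg g (Subtype.ext he))

theorem finite_leaf_addNode (hf : ∀ i, Finite (E.Leaf i)) :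
    ∀ i, Finite ((E.addNode t a b f g).Leaf i)
  | some i => hf i
  | none => by
    have := hf p₀.node
    have := p₀.T.finite_edge p₀.μ
    exact inferInstanceAs (Finite (E.CommonEdge p₀ a b))

/-- The two new arcs are normalized, since the expansion tree represents only orders in both
projections. -/
theorem isUniform_addNode (hf : ∀ i, Finite (E.Leaf i)) (hu : E.IsUniform)
    (ht : E.IsExpansionTree p₀ a b t f g) : (E.addNode t a b f g).IsUniform := by
  have hf' := finite_leaf_addNode (t := t) (f := f) (g := g) hf
  rintro (d | d) p q l₁ l₂ l₃ hp hq
  · obtain ⟨p, -, rfl⟩ := exists_addNode_eq (p := p) hp.1.symm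
    obtain ⟨q, -, rfl⟩ := exists_addNode_eq (p := q) hq.1.symm
    exact stems_addNode.2 (hu d p q _ _ _ (sepTgt_addNode.1 hp) (sepSrc_addNode.1 hq))
  · refine stems_of_normalized hf' (fun O' hO' => ?_) hp hq
    have hO' : O' ∈ orders t := hO'
    rw [ht.2.2] at hO'
    cases d
    exacts [hO'.1, hO'.2]

theorem not_fixes_of_node_eq_none {p : (E.addNode t a b f g).PNode} (hp : p.node = none)
    (d : (E.addNode t a b f g).Arc) : ¬ (E.addNode t a b f g).Fixes d p := by
  intro h
  obtain ⟨l₁, l₂, l₃, h, -⟩ := fixes_iff.1 h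
  rw [hp] at h
  rcases d with d | _ | _ <;> cases h

theorem Stage.Invariant.expand (h : E.Invariant H) (hc : E.IsCritical p₀ a b)
    (hn : (p₀, s(a, b)) ∉ E.processed) (ht : E.IsExpansionTree p₀ a b t f g) :
    (E.expand p₀ a b t f g).Invariant
      ((fun p => p.addNode t a b f g) '' H ∪ {p | p.node = none}) := by
  classical
  set H' := (fun p : E.PNode => p.addNode t a b f g) '' H ∪ {p | p.node = none}
  have hf' := finite_leaf_addNode (t := t) (f := f) (g := g) h.finite_leaf
  have hmem : ∀ p : E.PNode, p.addNode t a b f g ∈ H' ↔ p ∈ H := by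
    intro p
    refine ⟨?_, fun hp => .inl ⟨p, hp, rfl⟩⟩
    rintro (⟨q, hq, he⟩ | hp)
    · exact PNode.addNode_injective he ▸ hq
    · cases hp
  have hold : ∀ p : E.PNode, ((E.expand p₀ a b t f g).load H' (p.addNode t a b f g)).encard ≤
      (E.load H p).encard := by
    intro p
    -- The credits `(a, p₀)` and `(b, p₀)` are redeemed for the two new arcs; all else is carried
    -- over. Both credits expire because the triple is now processed.
    let ψ : E.Arc ⊕ E.Arc × E.PNode →
        (E.Arc ⊕ Bool) ⊕ (E.Arc ⊕ Bool) × (E.addNode t a b f g).PNode := fun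
      | inl d => inl (inl d)
      | inr (d, q) => if (d, q) = (a, p₀) then inl (inr false) else
          if (d, q) = (b, p₀) then inl (inr true) else inr (inl d, q.addNode t a b f g)
    refine (Set.encard_le_encard ?_).trans (Set.encard_image_le ψ _)
    rintro ((d | _ | _) | ⟨d, q⟩) hx
    · exact ⟨inl d, Stage.mem_load_inl.2 (fixes_addNode.1 (Stage.mem_load_inl.1 hx)), rfl⟩
    · have hs := stems_of_fixes_addNode h.uniform ht (Stage.mem_load_inl.1 hx)
      exact ⟨_, h.mem_load hc hn hs, by simp [ψ]; rfl⟩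
    · have hs := stems_of_fixes_addNode' h.uniform ht (Stage.mem_load_inl.1 hx)
      exact ⟨_, h.mem_load hc.symm (by rwa [Sym2.eq_swap]) hs, by simp [ψ, hc.1.symm]; rfl⟩
    · obtain ⟨hs, hq, hp⟩ := Stage.mem_load_inr.1 hx
      obtain ⟨h₁, h₂, -⟩ := stems_iff.1 hs
      rcases d with d | d
      swap
      · cases h₁
      obtain ⟨q, -, rfl⟩ := exists_addNode_eq (p := q) h₂.symm
      have hpr : ∀ c, (q, s(d, c)) ∉ insert (p₀, s(a, b)) E.processed :=
        fun c hm => hp (inl c) ⟨_, hm, rfl⟩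
      have hne : (d, q) ≠ (a, p₀) := by
        rintro ⟨⟩
        exact hpr b (.inl rfl)
      have hne' : (d, q) ≠ (b, p₀) := by
        rintro ⟨⟩
        exact hpr a (.inl (by rw [Sym2.eq_swap]))
      refine ⟨inr (d, q), Stage.mem_load_inr.2 ⟨stems_addNode.1 hs, (hmem q).1 hq,
        fun c hm => hpr c (.inr hm)⟩, ?_⟩
      simp only [ψ, hne, hne', if_false]
      rfl
  -- The new tree is a sink with two incoming arcs, and each arc yields at most one P-node from
  -- which `p` stems.
  have hnew : ∀ p : (E.addNode t a b f g).PNode, p.node = none →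
      ((E.expand p₀ a b t f g).load H' p).encard ≤ 2 := by
    intro p hp
    let φ : (E.Arc ⊕ Bool) ⊕ (E.Arc ⊕ Bool) × (E.addNode t a b f g).PNode → E.Arc ⊕ Bool := fun
      | inl d => d
      | inr (d, _) => d
    have h2 : ({inr false, inr true} : Set (E.Arc ⊕ Bool)).encard ≤ 2 := by
      rw [Set.encard_pair (by simp)]
    refine le_trans (Set.encard_le_encard_of_injOn (f := φ) ?_ ?_) h2
    · rintro (d | ⟨d, q⟩) hx
      · exact absurd (Stage.mem_load_inl.1 hx) (not_fixes_of_node_eq_none hp d)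
      · obtain ⟨h₁, -⟩ := stems_iff.1 (Stage.mem_load_inr.1 hx).1
        rw [hp] at h₁
        rcases d with d | _ | _
        · cases h₁
        · exact .inl rfl
        · exact .inr rfl
    · rintro (d | ⟨d, q⟩) hx (d' | ⟨d', q'⟩) hx' he
      · exact absurd (Stage.mem_load_inl.1 hx) (not_fixes_of_node_eq_none hp d)
      · exact absurd (Stage.mem_load_inl.1 hx) (not_fixes_of_node_eq_none hp d)
      · exact absurd (Stage.mem_load_inl.1 hx') (not_fixes_of_node_eq_none hp d')
      · obtain rfl : d = d' := he
        rw [(Stage.mem_load_inr.1 hx).1.unique hf' (Stage.mem_load_inr.1 hx').1]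
  refine ⟨hf', isUniform_addNode h.finite_leaf h.uniform ht, ?_, fun p => ?_, fun p hp => ?_⟩
  · rintro p c d ⟨⟨q, s⟩, hm, he⟩
    have hcr : ∀ c d, s = s(c, d) → E.IsCritical q c d := by
      rcases hm with hm | hm
      · cases hm
        exact fun c d he => hc.congr he
      · rintro c d rfl
        exact h.critical _ _ _ hm
    induction s using Sym2.ind with
    | _ c' d' =>
      obtain ⟨hq, he'⟩ := Prod.mk.inj he
      subst hq
      have hcr := hcr c' d' rfl
      have : (E.expand p₀ a b t f g).IsCritical (q.addNode t a b f g) (inl c') (inl d') :=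
        ⟨inl_injective.ne hcr.1, fixes_addNode.2 hcr.2.1, fixes_addNode.2 hcr.2.2⟩
      exact this.congr he'
  · cases hp : p.node with
    | none => exact hnew p hp
    | some i =>
      obtain ⟨p, -, rfl⟩ := exists_addNode_eq hp
      exact (hold p).trans (h.load_le_two p)
  · cases hp' : p.node with
    | none => exact absurd (.inr hp') hp
    | some i =>
      obtain ⟨p, -, rfl⟩ := exists_addNode_eq hp'
      exact (hold p).trans (h.load_le_one p fun hm => hp ((hmem p).2 hm))

end Expand

/-! ### Finalizing steps -/

section Finalize

variable {E : Stage} {H : Set E.PNode} {p₀ : E.PNode} {a b : E.Arc}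
  {f : E.Leaf (E.tgt b) → E.Leaf (E.tgt a)}

/-- The stage after a finalizing step. -/
abbrev Stage.finalize (E : Stage) (p₀ : E.PNode) (a b : E.Arc)
    (f : E.Leaf (E.tgt b) → E.Leaf (E.tgt a)) : Stage where
  toPQGraph := E.toPQGraph.addArc (E.tgt a) (E.tgt b) f
  expTree := E.expTree
  processed := (fun s => (s.1.addArc (E.tgt a) (E.tgt b) f, s.2.map some)) ''
    insert (p₀, s(a, b)) E.processed

/-- Leaves separated at the P-node of the target of `b` lie on different edges at `p₀`. As `f`
respects these edges, their images are distinct, hence separated at the single P-node of the target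
of `a`. -/
theorem isUniform_addArc (hfin : ∀ i, Finite (E.Leaf i)) (hu : E.IsUniform)
    (hc : E.IsCritical p₀ a b) (hF : E.IsFinalizable p₀ a b)
    (hf : ∀ l, ∃ e, E.Hits p₀ b l e ∧ E.Hits p₀ a (f l) e) :
    (E.addArc (E.tgt a) (E.tgt b) f).IsUniform := by
  rintro (_ | d) p q l₁ l₂ l₃ hp hq
  all_goals
    obtain ⟨p, rfl⟩ := PNode.addArc_surjective p
    obtain ⟨q, rfl⟩ := PNode.addArc_surjective q
  swap
  · exact hu d p q l₁ l₂ l₃ hp hq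
  refine (stems_iff (D := E.addArc (E.tgt a) (E.tgt b) f)).2 ⟨hp.1, hq.1, fun m₁ m₂ m₃ hm => ?_⟩
  have hs := hF.2.1.stems hfin hu (p := p) hp.1 hc.2.2
  have hm : SepSrc p₀ b m₁ m₂ m₃ := (stems_iff.1 hs).2.2 m₁ m₂ m₃ hm
  obtain ⟨e₁, e₂, e₃, h₁₂, h₂₃, h₁₃, h₁, h₂, h₃⟩ := sepSrc_iff_hits.1 hm
  have key : ∀ {m m' e e'}, E.Hits p₀ b m e → E.Hits p₀ b m' e' → e ≠ e' → f m ≠ f m' := by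
    intro m m' e e' h h' hne he
    obtain ⟨x, hx, hx'⟩ := hf m
    obtain ⟨y, hy, hy'⟩ := hf m'
    rw [← he] at hy'
    exact hne ((h.unique hx).trans ((hx'.unique hy').trans (hy.unique h')))
  exact hF.1.sepTgt hfin (p := q) hq.1 (key h₁ h₂ h₁₂) (key h₂ h₃ h₂₃) (key h₁ h₃ h₁₃)

theorem Stage.Invariant.finalize (h : E.Invariant H) (hc : E.IsCritical p₀ a b)
    (hn : (p₀, s(a, b)) ∉ E.processed) (hF : E.IsFinalizable p₀ a b)
    (hf : ∀ l, ∃ e, E.Hits p₀ b l e ∧ E.Hits p₀ a (f l) e) :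
    (E.finalize p₀ a b f).Invariant ((fun p => p.addArc (E.tgt a) (E.tgt b) f) '' H) := by
  classical
  set H' := (fun p : E.PNode => p.addArc (E.tgt a) (E.tgt b) f) '' H
  have hmem : ∀ p : E.PNode, p.addArc (E.tgt a) (E.tgt b) f ∈ H' ↔ p ∈ H :=
    fun p => PNode.addArc_injective.mem_set_image
  have hold : ∀ p : E.PNode, ((E.finalize p₀ a b f).load H'
      (p.addArc (E.tgt a) (E.tgt b) f)).encard ≤ (E.load H p).encard := by
    intro p
    obtain ⟨q₀, hq₀⟩ : ∃ q : E.PNode, q.node = E.tgt a := by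
      obtain ⟨T, μ, hT, hμ, -⟩ := hF.1
      exact ⟨⟨_, T, hT, μ, hμ⟩, rfl⟩
    -- The credit `(a, p₀)` pays for the new arc as one fixing the P-node `q₀` of its source. The
    -- credit `(b, p₀)` becomes the credit of the new arc at its target, where `q₀` is the only
    -- P-node to stem from.
    let ψ : E.Arc ⊕ E.Arc × E.PNode →
        Option E.Arc ⊕ Option E.Arc × (E.addArc (E.tgt a) (E.tgt b) f).PNode := fun
      | inl d => inl (some d)
      | inr (d, q) => if (d, q) = (a, p₀) then inl none else
          if (d, q) = (b, p₀) then inr (none, q₀.addArc (E.tgt a) (E.tgt b) f) else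
            inr (some d, q.addArc (E.tgt a) (E.tgt b) f)
    refine (Set.encard_le_encard ?_).trans (Set.encard_image_le ψ _)
    rintro ((_ | d) | ⟨d, q⟩) hx
    · obtain ⟨_, _, _, hp, -⟩ := fixes_iff.1 (Stage.mem_load_inl.1 hx)
      have hs := hF.1.stems h.finite_leaf h.uniform (p := p) hp hc.2.1
      exact ⟨_, h.mem_load hc hn hs, by simp [ψ]; rfl⟩
    · exact ⟨inl d, Stage.mem_load_inl.2 (Stage.mem_load_inl (E := E.finalize p₀ a b f).1 hx), rfl⟩
    · obtain ⟨hs, hq, hp⟩ := Stage.mem_load_inr.1 hx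
      obtain ⟨q, rfl⟩ := PNode.addArc_surjective q
      obtain ⟨h₁, h₂, -⟩ := stems_iff.1 hs
      rcases d with _ | d
      · obtain rfl : q₀ = q := hF.1.unique hq₀ h₂.symm
        have hs := hF.2.1.stems h.finite_leaf h.uniform (p := p) h₁ hc.2.2
        exact ⟨_, h.mem_load hc.symm (by rwa [Sym2.eq_swap]) hs, by simp [ψ, hc.1.symm]; rfl⟩
      have hpr : ∀ c, (q, s(d, c)) ∉ insert (p₀, s(a, b)) E.processed :=
        fun c hm => hp (some c) ⟨_, hm, rfl⟩
      have hne : (d, q) ≠ (a, p₀) := by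
        rintro ⟨⟩
        exact hpr b (.inl rfl)
      have hne' : (d, q) ≠ (b, p₀) := by
        rintro ⟨⟩
        exact hpr a (.inl (by rw [Sym2.eq_swap]))
      refine ⟨inr (d, q), Stage.mem_load_inr.2 ⟨stems_addArc.1 hs, (hmem q).1 hq,
        fun c hm => hpr c (.inr hm)⟩, ?_⟩
      simp only [ψ, hne, hne', if_false]
      rfl
  refine ⟨h.finite_leaf, isUniform_addArc h.finite_leaf h.uniform hc hF hf, ?_, fun p => ?_,
    fun p hp => ?_⟩
  · rintro p c d ⟨⟨q, s⟩, hm, he⟩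
    have hcr : ∀ c d, s = s(c, d) → E.IsCritical q c d := by
      rcases hm with hm | hm
      · cases hm
        exact fun c d he => hc.congr he
      · rintro c d rfl
        exact h.critical _ _ _ hm
    induction s using Sym2.ind with
    | _ c' d' =>
      obtain ⟨hq, he'⟩ := Prod.mk.inj he
      subst hq
      have hcr := hcr c' d' rfl
      have : (E.finalize p₀ a b f).IsCritical (q.addArc (E.tgt a) (E.tgt b) f)
          (some c') (some d') :=
        ⟨(Option.some_injective _).ne hcr.1, hcr.2.1, hcr.2.2⟩
      exact this.congr he'
  · obtain ⟨p, rfl⟩ := PNode.addArc_surjective p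
    exact (hold p).trans (h.load_le_two p)
  · obtain ⟨p, rfl⟩ := PNode.addArc_surjective p
    exact (hold p).trans (h.load_le_one p fun hm => hp ((hmem p).2 hm))

end Finalize

/-- Marking a critical triple as processed preserves the invariant. -/
theorem Stage.Invariant.mark {E : Stage} {H : Set E.PNode} (h : E.Invariant H) {p : E.PNode}
    {a b : E.Arc} (hc : E.IsCritical p a b) :
    Stage.Invariant { E with processed := insert (p, s(a, b)) E.processed } H := by
  have hsub : ∀ q, Stage.load { E with processed := insert (p, s(a, b)) E.processed } H q ⊆
      E.load H q := fun q =>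
    Set.union_subset_union_right _ (Set.image_mono fun s hs =>
      ⟨hs.1, hs.2.1, fun c hm => hs.2.2 c (.inr hm)⟩)
  refine ⟨h.finite_leaf, h.uniform, ?_, fun q => (Set.encard_le_encard (hsub q)).trans
    (h.load_le_two q), fun q hq => (Set.encard_le_encard (hsub q)).trans (h.load_le_one q hq)⟩
  rintro q c d (hm | hm)
  · obtain ⟨hq, he⟩ := Prod.mk.inj hm
    have hc' : E.IsCritical q a b := hq ▸ hc
    exact hc'.congr he.symm
  · exact h.critical _ _ _ hm

/-! ### Induction over the steps of the expansion -/

theorem Step.exists_invariant {E E' : Stage} (hs : Step E E') (h : ∃ H, E.Invariant H) :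
    ∃ H, E'.Invariant H := by
  obtain ⟨H, h⟩ := h
  cases hs with
  | expand p a b t f g crit unproc cond exp => exact ⟨_, h.expand crit unproc exp⟩
  | finalize p a b f crit unproc cond path hf => exact ⟨_, h.finalize crit unproc cond hf⟩
  | doubleArc p a b crit unproc cond tgt_eq mem => exact ⟨H, h.mark crit⟩

end SimPQ

theorem mainTheorem3 (D : SimPQ.Instance) (hD : D.IsFixed 2) : D.IsOneCritical := by
  intro E hE
  have h : ∃ H, E.Invariant H := by
    induction hE with
    | refl => exact ⟨_, SimPQ.Instance.initialStage_invariant hD⟩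
    | tail _ hs ih => exact hs.exists_invariant ih
  obtain ⟨H, h⟩ := h
  exact h.atMostOneCritical
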